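/- **Setting.** Let $\mathcal A\subset\mathbb Z^d$ be a finite set whose convex hull $\Delta\subset\mathbb R^d$ has dimension $d$, and let $w=(w_{\mathbf a})_{\mathbf a\in\mathcal A}$ be positive real weights. Put $\varphi_{\mathcal A,w}(x)=[w_{\mathbf a}x^{\mathbf a}\mid\mathbf a\in\mathcal A]$. Let $Y_{\mathcal A,w}\subset\mathbb{CP}^{\mathcal A}$ be the Zariski closure of $\varphi_{\mathcal A,w}((\mathbb C^\times)^d)$, and let $X_{\mathcal A,w}$ be the closure of the toric model $\varphi_{\mathcal A,w}(\mathbb R_{>}^d)$ in $\mathbb{RP}^{\mathcal A}_{\ge}$, which is identified with the probability simplex in $\mathbb R^{\mathcal A}$. The tautological projection $\pi_{\mathcal A}\colon Y_{\mathcal A,w}\dashrightarrow\mathbb{CP}^d$ sends $[y_{\mathbf a}]$ to $\bigl[\sum_{\mathbf a}y_{\mathbf a}(1,\mathbf a)\bigr]$ where this is non-zero; its degree is the number of points in a general fibre. A *patch* is a family $\beta=(\beta_{\mathbf a})_{\mathbf a\in\mathcal A}$ of continuous non-negative functions on $\Delta$ without common zeros; its normalized blending functions are $\bar\beta_{\mathbf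 a}=\beta_{\mathbf a}/\sum_{\mathbf b}\beta_{\mathbf b}$. It is a *toric patch of shape $(\mathcal A,w)$* if the image of $x\mapsto[\beta_{\mathbf a}(x)]$ is $X_{\mathcal A,w}$. It is *proper* if its tautological map $\tau(x)=\sum_{\mathbf a}\bar\beta_{\mathbf a}(x)\,\mathbf a$ is a homeomorphism $\Delta\to\Delta$. It has *linear precision* if $\Lambda(x)=\sum_{\mathbf a}\bar\beta_{\mathbf a}(x)\Lambda(\mathbf a)$ on $\Delta$ for every affine function $\Lambda$. It has *rational linear precision* if it is proper and its reparametrization $\beta\circ\psi$, with $\psi$ a homeomorphism of $\Delta$, that has linear precision has normalized blending functions which are rational functions, that is, quotients $P/Q$ of polynomials, $Q\ne0$, wherever $Q$ does not vanish. We say that $X_{\mathcal A,w}$ has rational linear precision if some toric patch of shape $(\mathcal A,w)$ has it. The *maximum likelihood degree* of $X_{\mathcal A,w}$ is the number, for general data $u\in\mathbb C^{\mathcal A}$, of complex critical points of the likelihood function $\prod_{\mathbf a}p_{\mathbf a}^{u_{\mathbf a}}$ on the model, where $p_{\mathbf a}=w_{\mathbf a}x^{\mathbf a}/\sum_{\mathbf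 b}w_{\mathbf b}x^{\mathbf b}$: these are the points $\varphi_{\mathcal A,w}(x)$ with $x\in(\mathbb C^\times)^d$ and $\sum_{\mathbf b}w_{\mathbf b}x^{\mathbf b}\neq0$ at which $\sum_{\mathbf a}u_{\mathbf a}\,dp_{\mathbf a}/p_{\mathbf a}=0$. **Proposition.** 1. $X_{\mathcal A,w}$ has rational linear precision if and only if its maximum likelihood degree is $1$. Moreover, every toric patch of shape $(\mathcal A,w)$ for which $x\mapsto[\beta_{\mathbf a}(x)]$ is injective on $\Delta$ has rational linear precision if and only if the maximum likelihood degree is $1$. 2. The maximum likelihood degree and the degree of $\pi_{\mathcal A}\colon Y_{\mathcal A,w}\dashrightarrow\mathbb{CP}^d$ are well defined, and they are equal. 3. Let $G$ be a decomposable graph on a finite vertex set $V$ (either complete, or $V=A\sqcup B\sqcup C$ with $A,B\neq\emptyset$, $C$ complete, no edges between $A$ and $B$, and the induced subgraphs on $A\cup C$ and $B\cup C$ decomposable), and let $S_v$, $v\in V$, be finite non-empty state spaces. The graphical model of $G$ is the set of strictly positive probability distributions on $\prod_vS_v$ that are products of positive potentials indexed by the cliques of $G$, each depending only on the states of the vertices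 in its clique. This model is the toric model of some $(\mathcal A,w)$ as above, with $\mathcal A$ indexed by $\prod_v S_v$. For every such $(\mathcal A,w)$ the maximum likelihood degree is $1$, $X_{\mathcal A,w}$ has rational linear precision, and so does every toric patch of shape $(\mathcal A,w)$ that is injective as in 1. -/

import Mathlib

open scoped LinearAlgebra.Projectivization

noncomputable section

/-! ### Parametric patches -/

/-- The domain polytope `Δ`: the convex hull of the points `p i` in `ℝ^d`. -/
def domainPolytope {d : ℕ} {ι : Type*} (p : ι → Fin d → ℝ) : Set (Fin d → ℝ) :=
  convexHull ℝ (Set.range p)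

/-- A parametric patch with indexing points `p i`: continuous non-negative blending functions on
the domain polytope which never vanish simultaneously. -/
structure ParametricPatch {d : ℕ} {ι : Type*} (p : ι → Fin d → ℝ) where
  blend : ι → domainPolytope p → ℝ
  continuous_blend : ∀ i, Continuous (blend i)
  nonneg : ∀ i x, 0 ≤ blend i x
  no_base_point : ∀ x, ∃ i, blend i x ≠ 0

namespace ParametricPatch

variable {d : ℕ} {ι : Type*} {p : ι → Fin d → ℝ}

/-- The normalized blending functions. -/
def normalized [Fintype ι] (β : ParametricPatch p) (i : ι) (x : domainPolytope p) : ℝ :=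
  β.blend i x / ∑ k, β.blend k x

/-- Linear precision: the patch replicates every affine function. -/
def HasLinearPrecision [Fintype ι] (β : ParametricPatch p) : Prop :=
  ∀ (L : (Fin d → ℝ) →ᵃ[ℝ] ℝ) (x : domainPolytope p),
    L (x : Fin d → ℝ) = ∑ i, β.normalized i x * L (p i)

/-- The tautological map of a patch. -/
def tautologicalMap [Fintype ι] (β : ParametricPatch p) (x : domainPolytope p) : Fin d → ℝ :=
  ∑ i, β.normalized i x • p i

/-- A patch is proper if its tautological map is a homeomorphism of `Δ` onto `Δ`. -/
def IsProper [Fintype ι] (β : ParametricPatch p) : Prop :=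
  ∃ e : domainPolytope p ≃ₜ domainPolytope p,
    ∀ x, ((e x : domainPolytope p) : Fin d → ℝ) = β.tautologicalMap x

/-- Reparametrization of a patch by a homeomorphism of its domain polytope. -/
def reparam (β : ParametricPatch p) (ψ : domainPolytope p ≃ₜ domainPolytope p) :
    ParametricPatch p where
  blend i x := β.blend i (ψ x)
  continuous_blend i := (β.continuous_blend i).comp ψ.continuous
  nonneg i x := β.nonneg i (ψ x)
  no_base_point x := β.no_base_point (ψ x)

/-- A real function on `Δ` is a rational function if it is a quotient `P / Q` of polynomials
wherever the (non-zero) polynomial `Q` does not vanish. The denominator may have zeros on `Δ`. -/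
def IsRationalFunction (f : domainPolytope p → ℝ) : Prop :=
  ∃ P Q : MvPolynomial (Fin d) ℝ, Q ≠ 0 ∧
    ∀ x : domainPolytope p, MvPolynomial.eval (x : Fin d → ℝ) Q ≠ 0 →
      f x = MvPolynomial.eval (x : Fin d → ℝ) P / MvPolynomial.eval (x : Fin d → ℝ) Q

/-- Rational linear precision: the patch is proper, and its reparametrization having linear
precision has normalized blending functions that are rational functions. -/
def HasRationalLinearPrecision [Fintype ι] (β : ParametricPatch p) : Prop :=
  β.IsProper ∧ ∃ ψ : domainPolytope p ≃ₜ domainPolytope p,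
    (β.reparam ψ).HasLinearPrecision ∧ ∀ i, IsRationalFunction ((β.reparam ψ).normalized i)

/-- The map `x ↦ [β_i(x)]` of `Δ` to the non-negative part of real projective space, which is
identified with the probability simplex. -/
def toSimplex [Fintype ι] (β : ParametricPatch p) (x : domainPolytope p) : ι → ℝ :=
  fun i => β.normalized i x

end ParametricPatch

/-! ### Toric models, toric patches and toric varieties -/

/-- The exponent vectors `a i ∈ ℤ^d`, viewed in `ℝ^d`. -/
def realPoints {d : ℕ} {ι : Type*} (a : ι → Fin d → ℤ) : ι → Fin d → ℝ :=
  fun i j => (a i j : ℝ)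

/-- The affine coordinates `w_i x^{a_i}` of the monomial parametrization, over `ℝ` or `ℂ`. -/
def weightedMonomials {K : Type*} [Field K] {d : ℕ} {ι : Type*}
    (a : ι → Fin d → ℤ) (w : ι → K) (x : Fin d → K) : ι → K :=
  fun i => w i * ∏ j, x j ^ a i j

/-- The normalized coordinates `w_i x^{a_i} / ∑ₖ w_k x^{a_k}`. -/
def modelProbability {K : Type*} [Field K] {d : ℕ} {ι : Type*} [Fintype ι]
    (a : ι → Fin d → ℤ) (w : ι → K) (i : ι) (x : Fin d → K) : K :=
  weightedMonomials a w x i / ∑ k, weightedMonomials a w x k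

/-- The toric model: the image of the positive orthant, in the probability simplex. -/
def toricModel {d : ℕ} {ι : Type*} [Fintype ι] (a : ι → Fin d → ℤ) (w : ι → ℝ) : Set (ι → ℝ) :=
  {q | ∃ x : Fin d → ℝ, (∀ j, 0 < x j) ∧ q = fun i => modelProbability a w i x}

/-- `β` is a toric patch of shape `(a, w)`: its image is the closure `X_{a,w}` of the toric
model. -/
def ParametricPatch.IsToric {d : ℕ} {ι : Type*} [Fintype ι] (a : ι → Fin d → ℤ) (w : ι → ℝ)
    (β : ParametricPatch (realPoints a)) : Prop :=
  Set.range β.toSimplex = closure (toricModel a w)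

/-- The translated toric variety `Y_{a,w}`: the Zariski closure in complex projective space of
the image of the complex torus under `x ↦ [w_i x^{a_i}]`. -/
def toricVariety {d : ℕ} {ι : Type*} (a : ι → Fin d → ℤ) (w : ι → ℝ) : Set (ℙ ℂ (ι → ℂ)) :=
  {y | ∀ (n : ℕ) (F : MvPolynomial ι ℂ), F.IsHomogeneous n →
    (∀ x : Fin d → ℂ, (∀ j, x j ≠ 0) →
      MvPolynomial.eval (weightedMonomials a (fun i => (w i : ℂ)) x) F = 0) →
    MvPolynomial.eval y.rep F = 0}

/-- The linear map `y ↦ ∑ y_i (1, a_i)` inducing the tautological projection to `ℂℙ^d`. -/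
def tautologicalLinear {d : ℕ} {ι : Type*} [Fintype ι] (a : ι → Fin d → ℤ) (y : ι → ℂ) :
    Fin (d + 1) → ℂ :=
  ∑ i, y i • (Fin.cons 1 (fun j => (a i j : ℂ)) : Fin (d + 1) → ℂ)

/-- The fibre over `z` of the tautological projection from `Y_{a,w}` to `ℂℙ^d` (which is defined
at the points where `tautologicalLinear` does not vanish). -/
def tautologicalFibre {d : ℕ} {ι : Type*} [Fintype ι] (a : ι → Fin d → ℤ) (w : ι → ℝ)
    (z : ℙ ℂ (Fin (d + 1) → ℂ)) : Set (ℙ ℂ (ι → ℂ)) :=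
  {y | y ∈ toricVariety a w ∧
    ∃ h : tautologicalLinear a y.rep ≠ 0, Projectivization.mk ℂ (tautologicalLinear a y.rep) h = z}

/-- `N` is the degree of the tautological projection from `Y_{a,w}` to `ℂℙ^d`: the number of
points in the fibre over a general point. -/
def IsTautologicalDegree {d : ℕ} {ι : Type*} [Fintype ι] (a : ι → Fin d → ℤ) (w : ι → ℝ)
    (N : ℕ) : Prop :=
  ∃ (n : ℕ) (G : MvPolynomial (Fin (d + 1)) ℂ), G.IsHomogeneous n ∧ G ≠ 0 ∧
    ∀ z : ℙ ℂ (Fin (d + 1) → ℂ), MvPolynomial.eval z.rep G ≠ 0 →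
      (tautologicalFibre a w z).encard = N

/-- The complex critical points, on the model, of the likelihood function `∏ p_i ^ u_i` with
data `u`: the points `[w_i x^{a_i}]` with `x` in the complex torus, and with non-zero coordinate
sum, at which the logarithmic differential `∑ u_i dp_i / p_i` vanishes. The points are counted on
the model, not in the parameter space. -/
def likelihoodCriticalPoints {d : ℕ} {ι : Type*} [Fintype ι] (a : ι → Fin d → ℤ) (w : ι → ℝ)
    (u : ι → ℂ) : Set (ℙ ℂ (ι → ℂ)) :=
  {y | ∃ x : Fin d → ℂ, (∀ j, x j ≠ 0) ∧
    (∃ h : weightedMonomials a (fun i => (w i : ℂ)) x ≠ 0,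
      y = Projectivization.mk ℂ (weightedMonomials a (fun i => (w i : ℂ)) x) h) ∧
    ∑ k, weightedMonomials a (fun i => (w i : ℂ)) x k ≠ 0 ∧
    ∑ i, (u i / modelProbability a (fun i => (w i : ℂ)) i x) •
      fderiv ℂ (modelProbability a (fun i => (w i : ℂ)) i) x = 0}

/-- `N` is the maximum likelihood degree of the model: the number of complex critical points of
the likelihood function for general data `u`. -/
def IsMLDegree {d : ℕ} {ι : Type*} [Fintype ι] (a : ι → Fin d → ℤ) (w : ι → ℝ) (N : ℕ) : Prop :=
  ∃ g : MvPolynomial ι ℂ, g ≠ 0 ∧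
    ∀ u : ι → ℂ, MvPolynomial.eval u g ≠ 0 → (likelihoodCriticalPoints a w u).encard = N

/-! ### Decomposable graphical models -/

/-- The subgraph induced by `G` on a set of vertices is decomposable: it is complete, or the set
is a disjoint union `A ∪ B ∪ C` with `A`, `B` non-empty, `C` complete and separating `A` from `B`,
such that the subgraphs on `A ∪ C` and `B ∪ C` are decomposable. -/
inductive SimpleGraph.IsDecomposableOn {V : Type*} (G : SimpleGraph V) : Set V → Prop
  | complete (s : Set V) : G.IsClique s → G.IsDecomposableOn s
  | glue (A B C : Set V) : Disjoint A B → Disjoint A C → Disjoint B C →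
      A.Nonempty → B.Nonempty → G.IsClique C → (∀ x ∈ A, ∀ y ∈ B, ¬ G.Adj x y) →
      G.IsDecomposableOn (A ∪ C) → G.IsDecomposableOn (B ∪ C) →
      G.IsDecomposableOn (A ∪ B ∪ C)

open Classical in
/-- The (log-linear) graphical model of `G` for discrete random variables with state spaces `S v`:
the strictly positive probability distributions on the joint states that are products of positive
potentials, one for each clique of `G` and depending only on the states of its vertices. -/
def graphicalModel {V : Type*} [Fintype V] (G : SimpleGraph V) (S : V → Type*)
    [Fintype (∀ v, S v)] : Set ((∀ v, S v) → ℝ) :=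
  {q | (∀ s, 0 < q s) ∧ ∑ s, q s = 1 ∧
    ∃ ψ : Finset V → (∀ v, S v) → ℝ, (∀ C s, 0 < ψ C s) ∧
      (∀ C s t, (∀ v ∈ C, s v = t v) → ψ C s = ψ C t) ∧
      ∀ s, q s = ∏ C ∈ Finset.univ.filter (fun C : Finset V => G.IsClique (C : Set V)), ψ C s}

/-! ### Admissible exponents and weights -/

/-- The standing assumptions on the data of a toric patch: the exponent vectors are distinct,
their convex hull has full dimension `d`, and the weights are positive. -/
structure IsToricData {d : ℕ} {ι : Type*} (a : ι → Fin d → ℤ) (w : ι → ℝ) : Prop where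
  injective : Function.Injective a
  full_dim : affineSpan ℝ (domainPolytope (realPoints a)) = ⊤
  pos : ∀ i, 0 < w i

end

/-! Write `μ(q) = ∑ q_i a_i` for the moment map. On the compact set `X`, the closure of the toric
model, it is a homeomorphism onto `Δ`: Birch's theorem (`exists_momentMap_eq_of_mem_interior`)
reaches the interior as critical values of a coercive exponential sum, and monotonicity of the
logarithm gives injectivity (`injOn_momentMap`). A patch with linear precision and image in `X` is a
section of `μ`, hence equals the inverse `ν : Δ → X`. Conversely, a toric patch that is injective
into the simplex has the homeomorphism `μ ∘ β` as tautological map, and reparametrizing by its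
inverse turns `β` into `ν`. So rational linear precision means that `ν` is rational.

On the algebraic side, let `y` be the generic point of the affine cone over `Y` and `z = ∑ y_i (1,
a_i)`. By Birch's theorem the projection of the positive torus contains an open cone, so the `d + 1`
forms `z` are algebraically independent, hence a transcendence basis of the function field. The
number of cone points over a general value of `z` is then `[ℂ(z, y) : ℂ(z)]`, and it is one exactly
if each `y_i` is rational in `z` (`exists_generic_fibre_card`). Restricted to positive real points,
this says that `ν` is rational.

Both degrees count this fibre (`isMLDegree_and_isTautologicalDegree`). The likelihood equations say
that a suitably scaled model point has the same projection as the data `u`; points of the cone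
outside the torus have a zero coordinate and lie over finitely many hyperplanes only.

For a decomposable graph, a model distribution is a product of integral powers of its clique
marginals. Clique marginals are affine functions of the moments, because indicators of clique states
are affine in the exponents. Hence `ν` is rational (`isMLDegree_one_of_isDecomposableOn`). -/

/-! ### Counting the points of a general fibre -/

section GenericFibre

open Polynomial

section ClearDenominators

variable {R K L : Type*} [CommRing R] [IsDomain R] [Field K] [Algebra R K] [IsFractionRing R K]
  [Field L] [Algebra R L] [Algebra K L] [IsScalarTower R K L]

/-- Common denominators for coefficients in the fraction field; used to move a primitive element
into `R[y]`. -/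
theorem exists_smul_eq_aeval_of_mem_adjoin {ι : Type*} (y : ι → L) {x : L}
    (hx : x ∈ Algebra.adjoin K (Set.range y)) :
    ∃ (r : R) (H : MvPolynomial ι R), r ≠ 0 ∧
      algebraMap R L r * x = MvPolynomial.aeval y H := by
  induction hx using Algebra.adjoin_induction with
  | mem x hx =>
    obtain ⟨i, rfl⟩ := hx
    exact ⟨1, MvPolynomial.X i, one_ne_zero, by simp⟩
  | algebraMap c =>
    obtain ⟨n, m, hm, rfl⟩ := IsFractionRing.div_surjective (A := R) c
    have hm0 : m ≠ 0 := nonZeroDivisors.ne_zero hm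
    refine ⟨m, MvPolynomial.C n, hm0, ?_⟩
    have : algebraMap R K m ≠ 0 := by
      simpa using (IsFractionRing.injective R K).ne hm0
    rw [IsScalarTower.algebraMap_apply R K L, ← map_mul, mul_div_cancel₀ _ this,
      MvPolynomial.algHom_C, IsScalarTower.algebraMap_apply R K L]
  | add x x' _ _ h h' =>
    obtain ⟨r, H, hr, e⟩ := h
    obtain ⟨r', H', hr', e'⟩ := h'
    refine ⟨r * r', MvPolynomial.C r' * H + MvPolynomial.C r * H', mul_ne_zero hr hr', ?_⟩
    simp only [map_add, map_mul, MvPolynomial.algHom_C, ← e, ← e']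
    ring
  | mul x x' _ _ h h' =>
    obtain ⟨r, H, hr, e⟩ := h
    obtain ⟨r', H', hr', e'⟩ := h'
    refine ⟨r * r', H * H', mul_ne_zero hr hr', ?_⟩
    simp only [map_mul, ← e, ← e']
    ring

-- For algebraic `θ`, `K(θ) = K[θ]`, so only the coefficients have denominators. This expresses the
-- coordinates of a point through a root of the minimal polynomial in a form that can be
-- specialized.
variable (R) in
theorem exists_smul_eq_aeval_of_primitive {θ : L} (hθ : IsIntegral K θ)
    (h : IntermediateField.adjoin K {θ} = ⊤) (x : L) :
    ∃ (r : R) (H : R[X]), r ≠ 0 ∧ algebraMap R L r * x = aeval θ H := by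
  have hx : x ∈ Algebra.adjoin K {θ} := by
    have : x ∈ (IntermediateField.adjoin K {θ}).toSubalgebra := by rw [h]; trivial
    rwa [IntermediateField.adjoin_simple_toSubalgebra_of_isAlgebraic hθ.isAlgebraic] at this
  rw [Algebra.adjoin_singleton_eq_range_aeval] at hx
  obtain ⟨F, rfl⟩ := hx
  obtain ⟨r, hr, e⟩ := IsLocalization.integerNormalization_spec (nonZeroDivisors R) F
  refine ⟨r, IsLocalization.integerNormalization (nonZeroDivisors R) F,
    nonZeroDivisors.ne_zero hr, ?_⟩
  rw [← aeval_map_algebraMap K, e, ← algebraMap_smul K r F, map_smul, Algebra.smul_def,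
    ← IsScalarTower.algebraMap_apply]
  rfl

/-- A separable polynomial over the fraction field satisfies a Bézout identity over the ring. -/
theorem exists_bezout_derivative {m : R[X]} (hm : (m.map (algebraMap R K)).Separable) :
    ∃ (h : R) (A B : R[X]), h ≠ 0 ∧ A * m + B * derivative m = C h := by
  obtain ⟨A, B, e⟩ := hm
  obtain ⟨r, hr, eA⟩ := IsLocalization.integerNormalization_spec (nonZeroDivisors R) A
  obtain ⟨t, ht, eB⟩ := IsLocalization.integerNormalization_spec (nonZeroDivisors R) B
  refine ⟨r * t, C t * IsLocalization.integerNormalization (nonZeroDivisors R) A,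
    C r * IsLocalization.integerNormalization (nonZeroDivisors R) B,
    mul_ne_zero (nonZeroDivisors.ne_zero hr) (nonZeroDivisors.ne_zero ht), ?_⟩
  apply Polynomial.map_injective _ (IsFractionRing.injective R K)
  rw [derivative_map] at e
  simp only [Polynomial.map_add, Polynomial.map_mul, eA, eB, map_C]
  rw [← algebraMap_smul K r A, ← algebraMap_smul K t B, smul_eq_C_mul, smul_eq_C_mul, map_mul, C_mul]
  linear_combination C ((algebraMap R K) r) * C ((algebraMap R K) t) * e

end ClearDenominators

/-- Substituting fractions `Q i / g` into a polynomial and clearing denominators, in two rings at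
once. -/
theorem exists_substitute_fractions {R A A' : Type*} [CommRing R] [CommRing A] [CommRing A']
    {ι : Type*} {g : R} {Q : ι → R[X]} {c : R →+* A} {ρ : A} {v : ι → A} {c' : R →+* A'} {ρ' : A'}
    {v' : ι → A'} (hv : ∀ i, c g * v i = (Q i).eval₂ c ρ)
    (hv' : ∀ i, c' g * v' i = (Q i).eval₂ c' ρ') (F : MvPolynomial ι R) :
    ∃ (n : ℕ) (H : R[X]), H.eval₂ c ρ = c g ^ n * F.eval₂ c v ∧
      H.eval₂ c' ρ' = c' g ^ n * F.eval₂ c' v' := by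
  induction F using MvPolynomial.induction_on with
  | C r => exact ⟨0, C r, by simp, by simp⟩
  | add F F' h h' =>
    obtain ⟨n, H, e, e'⟩ := h
    obtain ⟨n', H', f, f'⟩ := h'
    refine ⟨n + n', C (g ^ n') * H + C (g ^ n) * H', ?_, ?_⟩
    · rw [eval₂_add, eval₂_mul, eval₂_mul, eval₂_C, eval₂_C, e, f, MvPolynomial.eval₂_add,
        map_pow, map_pow]
      ring
    · rw [eval₂_add, eval₂_mul, eval₂_mul, eval₂_C, eval₂_C, e', f', MvPolynomial.eval₂_add,
        map_pow, map_pow]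
      ring
  | mul_X F i h =>
    obtain ⟨n, H, e, e'⟩ := h
    refine ⟨n + 1, H * Q i, ?_, ?_⟩
    · rw [eval₂_mul, e, MvPolynomial.eval₂_mul, MvPolynomial.eval₂_X, ← hv i]
      ring
    · rw [eval₂_mul, e', MvPolynomial.eval₂_mul, MvPolynomial.eval₂_X, ← hv' i]
      ring

/-- The ring homomorphisms to an algebraically closed field from the ring generated by `y` over
`R`, extending a general homomorphism on `R`, are as many as the degree of the extension of
fraction fields. -/
theorem exists_generic_card_points {R K L : Type*} {k : Type*} [CommRing R] [IsDomain R]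
    [IsIntegrallyClosed R] [Field K] [Algebra R K] [IsFractionRing R K] [CharZero K]
    [Field L] [Algebra R L] [Algebra K L] [IsScalarTower R K L] [FiniteDimensional K L]
    [Field k] [IsAlgClosed k]
    {ι : Type*} [Finite ι] (y : ι → L) (hy : Algebra.adjoin K (Set.range y) = ⊤) :
    ∃ g : R, g ≠ 0 ∧ ∀ c : R →+* k, c g ≠ 0 →
      {v : ι → k | ∀ F : MvPolynomial ι R, MvPolynomial.aeval y F = 0 →
        F.eval₂ c v = 0}.encard = Module.finrank K L := by
  classical
  have := Fintype.ofFinite ι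
  have hRL : Function.Injective (algebraMap R L) := by
    rw [IsScalarTower.algebraMap_eq R K L]
    exact (algebraMap K L).injective.comp (IsFractionRing.injective R K)
  have : FaithfulSMul R L := (faithfulSMul_iff_algebraMap_injective R L).2 hRL
  obtain ⟨θ₀, hθ₀⟩ := Field.exists_primitive_element K L
  -- a primitive element that is integral and lies in `R[y]`
  obtain ⟨θ, H, hθ, hint, hH⟩ : ∃ (θ : L) (H : MvPolynomial ι R),
      IntermediateField.adjoin K {θ} = ⊤ ∧ IsIntegral R θ ∧ MvPolynomial.aeval y H = θ := by
    obtain ⟨r, H, hr, e⟩ := exists_smul_eq_aeval_of_mem_adjoin (R := R) (K := K) y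
      (x := θ₀) (by rw [hy]; trivial)
    -- The factor `r` moves `θ₀` into `R[y]` and `t` makes it integral over `R`; each property
    -- survives the other factor.
    have halg : IsAlgebraic R θ₀ :=
      (IsFractionRing.isAlgebraic_iff R K L).2 (Algebra.IsAlgebraic.isAlgebraic θ₀)
    obtain ⟨t, ht, hti⟩ := halg.exists_integral_multiple
    refine ⟨algebraMap R L (r * t) * θ₀, MvPolynomial.C t * H, ?_, ?_, ?_⟩
    · rw [eq_top_iff, ← hθ₀, IntermediateField.adjoin_simple_le_iff]
      have hne : algebraMap R L (r * t) ≠ 0 := by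
        simpa using hRL.ne (mul_ne_zero hr ht)
      have h1 := IntermediateField.mem_adjoin_simple_self K (algebraMap R L (r * t) * θ₀)
      have h2 : algebraMap R L (r * t) ∈
          IntermediateField.adjoin K {algebraMap R L (r * t) * θ₀} := by
        rw [IsScalarTower.algebraMap_apply R K L]
        exact IntermediateField.algebraMap_mem _ _
      have := mul_mem (inv_mem h2) h1
      rwa [inv_mul_cancel_left₀ hne] at this
    · rw [map_mul, mul_assoc, ← Algebra.smul_def t]
      exact (isIntegral_algebraMap).mul hti
    · rw [map_mul, map_mul, mul_assoc, mul_left_comm, e, MvPolynomial.algHom_C]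
  have hKint : IsIntegral K θ := IsIntegral.of_finite K θ
  -- As `R` is integrally closed, `m` is also the minimal polynomial over `K`, and it divides in
  -- `R[X]` every polynomial vanishing at `θ`.
  set m := minpoly R θ with hm
  have hmon : m.Monic := minpoly.monic hint
  have hmK : minpoly K θ = m.map (algebraMap R K) :=
    minpoly.isIntegrallyClosed_eq_field_fractions' K hint
  have hdeg : m.natDegree = Module.finrank K L := by
    rw [← (Field.primitive_element_iff_minpoly_natDegree_eq K θ).1 hθ, hmK,
      hmon.natDegree_map]
  have hdvd : ∀ p : R[X], aeval θ p = 0 → m ∣ p := fun p hp =>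
    minpoly.isIntegrallyClosed_dvd hint hp
  -- The element `h` plays the role of a discriminant: where `c h ≠ 0`, the specialization of `m`
  -- stays separable.
  obtain ⟨h, A, B, hh, hAB⟩ := exists_bezout_derivative (K := K) (m := m)
    (by rw [← hmK]; exact Algebra.IsSeparable.isSeparable K θ)
  choose gi Qi hgi hQi using fun i => exists_smul_eq_aeval_of_primitive R hKint hθ (y i)
  set g : R := ∏ i, gi i with hg
  have hg0 : g ≠ 0 := Finset.prod_ne_zero_iff.2 fun i _ => hgi i
  obtain ⟨Q, hQ⟩ : ∃ Q : ι → R[X], ∀ i, algebraMap R L g * y i = aeval θ (Q i) := by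
    refine ⟨fun i => C (∏ j ∈ Finset.univ.erase i, gi j) * Qi i, fun i => ?_⟩
    rw [hg, ← Finset.prod_erase_mul _ _ (Finset.mem_univ i), map_mul, mul_assoc, hQi, map_mul,
      aeval_C]
  refine ⟨g * h, mul_ne_zero hg0 hh, fun c hc => ?_⟩
  rw [map_mul] at hc
  have hcg : c g ≠ 0 := left_ne_zero_of_mul hc
  have hch : c h ≠ 0 := right_ne_zero_of_mul hc
  have hroot : ∀ {p : R[X]} {ρ : k}, aeval θ p = 0 → m.eval₂ c ρ = 0 → p.eval₂ c ρ = 0 := by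
    intro p ρ hp hρ
    obtain ⟨q, rfl⟩ := hdvd p hp
    rw [eval₂_mul, hρ, zero_mul]
  have hgy : ∀ i, algebraMap R L g * y i = (Q i).eval₂ (algebraMap R L) θ := hQ
  -- a root `ρ` of the specialized minimal polynomial gives the point `v ρ` of the fibre
  set v : k → ι → k := fun ρ i => (c g)⁻¹ * (Q i).eval₂ c ρ with hvdef
  have hv : ∀ ρ i, c g * v ρ i = (Q i).eval₂ c ρ := fun ρ i => mul_inv_cancel_left₀ hcg _
  -- Identities `F(y) = P(θ)` specialize: after clearing powers of `g`, their difference is a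
  -- multiple of `m`.
  have hrel : ∀ (F : MvPolynomial ι R) (P : R[X]) (ρ : k), m.eval₂ c ρ = 0 →
      MvPolynomial.aeval y F = aeval θ P → F.eval₂ c (v ρ) = P.eval₂ c ρ := by
    intro F P ρ hρ hF
    obtain ⟨n, T, h1, h2⟩ := exists_substitute_fractions hgy (hv ρ) F
    have h3 : aeval θ (T - C (g ^ n) * P) = 0 := by
      rw [map_sub, map_mul, aeval_C, ← hF, aeval_def, h1, MvPolynomial.aeval_def, map_pow, sub_self]
    have h4 := hroot h3 hρ
    rw [eval₂_sub, eval₂_mul, eval₂_C, h2, map_pow, ← mul_sub] at h4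
    exact sub_eq_zero.1 ((mul_eq_zero.1 h4).resolve_left (pow_ne_zero _ hcg))
  -- A point `x` of the fibre determines the root `H(x)`, since `H(y) = θ`; the map `v` recovers the
  -- point from the root.
  have himage : {v : ι → k | ∀ F : MvPolynomial ι R, MvPolynomial.aeval y F = 0 →
      F.eval₂ c v = 0} = v '' {ρ | m.eval₂ c ρ = 0} := by
    ext x
    constructor
    · intro hx
      have hcomp : (MvPolynomial.eval₂Hom c x).comp (algebraMap R (MvPolynomial ι R)) = c := by
        ext; simp
      refine ⟨H.eval₂ c x, ?_, ?_⟩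
      · have := hx (aeval H m) (by rw [← aeval_algHom_apply, hH]; exact minpoly.aeval R θ)
        rwa [← MvPolynomial.coe_eval₂Hom, aeval_def, hom_eval₂, hcomp] at this
      · funext i
        have := hx (MvPolynomial.C g * MvPolynomial.X i - aeval H (Q i)) (by
          rw [map_sub, ← aeval_algHom_apply, hH, map_mul, MvPolynomial.aeval_X,
            MvPolynomial.algHom_C, hQ, sub_self])
        rw [MvPolynomial.eval₂_sub, MvPolynomial.eval₂_mul, MvPolynomial.eval₂_C,
          MvPolynomial.eval₂_X, sub_eq_zero] at this
        apply mul_left_cancel₀ hcg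
        rw [hv, this, ← MvPolynomial.coe_eval₂Hom, aeval_def, hom_eval₂, hcomp]
    · rintro ⟨ρ, hρ, rfl⟩ F hF
      simpa using hrel F 0 ρ hρ (by simpa using hF)
  have hinj : Set.InjOn v {ρ | m.eval₂ c ρ = 0} := by
    intro ρ hρ ρ' hρ' e
    have h1 := hrel H X ρ hρ (by rw [hH, aeval_X])
    have h2 := hrel H X ρ' hρ' (by rw [hH, aeval_X])
    rw [eval₂_X] at h1 h2
    rw [← h1, ← h2, e]
  have hsep : (m.map c).Separable := by
    refine ⟨C (c h)⁻¹ * A.map c, C (c h)⁻¹ * B.map c, ?_⟩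
    have := congrArg (Polynomial.map c) hAB
    rw [Polynomial.map_add, Polynomial.map_mul, Polynomial.map_mul, map_C] at this
    rw [derivative_map, mul_assoc, mul_assoc, ← mul_add, this, ← C_mul, inv_mul_cancel₀ hch, C_1]
  have hset : {ρ | m.eval₂ c ρ = 0} = ((m.map c).rootSet k : Set k) := by
    ext ρ
    rw [mem_rootSet_of_ne (hmon.map c).ne_zero]
    simp [eval₂_eq_eval_map]
  have hspl : ((m.map c).map (algebraMap k k)).Splits := IsAlgClosed.splits _
  rw [himage, hinj.encard_image, hset, ← hdeg, ← hmon.natDegree_map c,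
    ← card_rootSet_eq_natDegree hsep hspl, Set.encard_eq_coe_toFinset_card,
    Set.toFinset_card]

/-- The points of the variety with generic point `y` over a general value of the algebraically
independent polynomial functions `z = Z(y)`, which `y` is algebraic over, have a constant number,
and this number is `1` exactly if `y` is a rational function of `z`. -/
theorem exists_generic_fibre_card {k L ι τ : Type*} [Field k] [IsAlgClosed k] [CharZero k]
    [Field L] [Algebra k L] [Finite ι] (y : ι → L) (z : τ → L) (Z : τ → MvPolynomial ι k)
    (hz : AlgebraicIndependent k z) (hZ : ∀ j, MvPolynomial.aeval y (Z j) = z j)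
    (halg : ∀ i, IsAlgebraic (Algebra.adjoin k (Set.range z)) (y i)) :
    ∃ N : ℕ, (N = 1 ↔ ∀ i, ∃ P Q : MvPolynomial τ k, Q ≠ 0 ∧
        y i * MvPolynomial.aeval z Q = MvPolynomial.aeval z P) ∧
      ∃ G : MvPolynomial τ k, G ≠ 0 ∧ ∀ c : τ → k, MvPolynomial.eval c G ≠ 0 →
        {v : ι → k | (∀ F : MvPolynomial ι k, MvPolynomial.aeval y F = 0 →
          MvPolynomial.eval v F = 0) ∧ ∀ j, MvPolynomial.eval v (Z j) = c j}.encard = N := by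
  classical
  -- Independence of `z` embeds the polynomial ring `R` into `L`, so `K` becomes the subfield
  -- `k(z)`. The number sought is the degree of `K(y)` over it.
  let R := MvPolynomial τ k
  let K := FractionRing R
  let algRL : Algebra R L := (MvPolynomial.aeval z).toRingHom.toAlgebra
  have hRLapply : ∀ r : R, algebraMap R L r = MvPolynomial.aeval z r := fun _ => rfl
  have hRL : Function.Injective (algebraMap R L) := hz
  have : FaithfulSMul R L := (faithfulSMul_iff_algebraMap_injective R L).2 hRL
  let algKL : Algebra K L := FractionRing.liftAlgebra R L
  have towerL : IsScalarTower R K L := FractionRing.isScalarTower_liftAlgebra R L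
  have : CharZero K := charZero_of_injective_algebraMap (IsFractionRing.injective R K)
  have halgK : ∀ i, IsIntegral K (y i) := by
    intro i
    have hR : IsAlgebraic R (y i) := by
      refine (halg i).of_ringHom_of_comp_eq hz.aevalEquiv (RingHom.id L)
        hz.aevalEquiv.surjective Function.injective_id ?_
      refine RingHom.ext fun r => ?_
      exact (hz.algebraMap_aevalEquiv r).trans (hRLapply r).symm
    exact ((IsFractionRing.isAlgebraic_iff R K L).1 hR).isIntegral
  let L₀ : IntermediateField K L := IntermediateField.adjoin K (Set.range y)
  have : FiniteDimensional K L₀ :=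
    IntermediateField.finiteDimensional_adjoin (by rintro _ ⟨i, rfl⟩; exact halgK i)
  let y₀ : ι → L₀ := fun i => ⟨y i, IntermediateField.subset_adjoin _ _ ⟨i, rfl⟩⟩
  have hy₀ : Algebra.adjoin K (Set.range y₀) = ⊤ := by
    rw [eq_top_iff]
    intro x _
    have hx : (x : L) ∈ (Algebra.adjoin K (Set.range y₀)).map L₀.val := by
      rw [AlgHom.map_adjoin, ← Set.range_comp]
      have h := IntermediateField.adjoin_toSubalgebra_of_isAlgebraic (F := K)
        (S := Set.range y) (by rintro _ ⟨i, rfl⟩; exact (halgK i).isAlgebraic)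
      have hx' : (x : L) ∈ (IntermediateField.adjoin K (Set.range y)).toSubalgebra := x.2
      rwa [h] at hx'
    obtain ⟨x', hx', e⟩ := hx
    rwa [← Subtype.ext (show (x' : L) = x from e)]
  obtain ⟨g, hg, hcard⟩ := exists_generic_card_points (R := R) (K := K) (k := k) y₀ hy₀
  refine ⟨Module.finrank K L₀, ?_, g, hg, fun c hc => ?_⟩
  · rw [IntermediateField.finrank_eq_one_iff, IntermediateField.adjoin_eq_bot_iff]
    constructor
    · intro h i
      obtain ⟨q, hq⟩ := IntermediateField.mem_bot.1 (h ⟨i, rfl⟩)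
      obtain ⟨n, m, hm, rfl⟩ := IsFractionRing.div_surjective (A := R) q
      have hm0 : m ≠ 0 := nonZeroDivisors.ne_zero hm
      refine ⟨n, m, hm0, ?_⟩
      have hm1 : algebraMap R L m ≠ 0 := by simpa using hRL.ne hm0
      rw [← hq, map_div₀, ← IsScalarTower.algebraMap_apply R K L,
        ← IsScalarTower.algebraMap_apply R K L, ← hRLapply, ← hRLapply, div_mul_cancel₀ _ hm1]
    · rintro h _ ⟨i, rfl⟩
      obtain ⟨P, Q, hQ, e⟩ := h i
      have hQ1 : algebraMap R L Q ≠ 0 := by simpa using hRL.ne hQ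
      refine IntermediateField.mem_bot.2 ⟨algebraMap R K P / algebraMap R K Q, ?_⟩
      rw [map_div₀, ← IsScalarTower.algebraMap_apply R K L,
        ← IsScalarTower.algebraMap_apply R K L, div_eq_iff hQ1]
      exact e.symm
  · rw [← hcard (MvPolynomial.eval c) hc]
    congr 1
    have hval : ∀ F : MvPolynomial ι R, MvPolynomial.aeval y₀ F = 0 ↔
        MvPolynomial.eval₂ (algebraMap R L) y F = 0 := by
      intro F
      have : MvPolynomial.eval₂ (algebraMap R L) y F = (MvPolynomial.aeval y₀ F : L₀) := by
        rw [MvPolynomial.aeval_def, ← IntermediateField.coe_val, ← RingHom.coe_coe,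
          MvPolynomial.eval₂_comp_left]
        rfl
      rw [this, ZeroMemClass.coe_eq_zero]
    ext v
    constructor
    · rintro ⟨hF, hc⟩ F hF0
      rw [hval] at hF0
      -- A relation with coefficients in `k[τ]` becomes one over `k` when the variables `τ` are
      -- replaced by the polynomials `Z`. This agrees with evaluating the coefficients at `z`,
      -- respectively at `c`.
      have h1 : (MvPolynomial.aeval y).toRingHom.comp
          (MvPolynomial.eval₂Hom (MvPolynomial.aeval Z).toRingHom MvPolynomial.X) =
          MvPolynomial.eval₂Hom (algebraMap R L) y := by
        refine MvPolynomial.ringHom_ext (fun r => ?_) (fun i => by simp)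
        have : ((MvPolynomial.aeval y).comp (MvPolynomial.aeval Z) : R →ₐ[k] L) =
            MvPolynomial.aeval z := by
          ext j; simp [hZ]
        simpa [hRLapply] using DFunLike.congr_fun this r
      have h2 : (MvPolynomial.eval v).comp
          (MvPolynomial.eval₂Hom (MvPolynomial.aeval Z).toRingHom MvPolynomial.X) =
          MvPolynomial.eval₂Hom (MvPolynomial.eval c) v := by
        refine MvPolynomial.ringHom_ext (fun r => ?_) (fun i => by simp)
        have : (MvPolynomial.eval v).comp (MvPolynomial.aeval Z : R →ₐ[k] _).toRingHom =
            MvPolynomial.eval c := by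
          refine MvPolynomial.ringHom_ext (fun r => by simp) (fun j => by simp [hc])
        simpa using DFunLike.congr_fun this r
      have h3 := hF (MvPolynomial.eval₂Hom (MvPolynomial.aeval Z).toRingHom MvPolynomial.X F)
        (by
          have := DFunLike.congr_fun h1 F
          exact this.trans hF0)
      exact (DFunLike.congr_fun h2 F).symm.trans h3
    · intro hv
      have h1 : ∀ F : MvPolynomial ι k,
          MvPolynomial.eval₂ (algebraMap R L) y (MvPolynomial.map MvPolynomial.C F) =
            MvPolynomial.aeval y F := by
        intro F
        rw [MvPolynomial.eval₂_map, MvPolynomial.aeval_def]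
        congr 1
        ext r
        exact (hRLapply _).trans (MvPolynomial.algHom_C _ r)
      have h2 : ∀ F : MvPolynomial ι k,
          MvPolynomial.eval₂ (MvPolynomial.eval c) v (MvPolynomial.map MvPolynomial.C F) =
            MvPolynomial.eval v F := by
        intro F
        rw [MvPolynomial.eval₂_map, MvPolynomial.eval]
        congr 1
        ext r
        simp
      refine ⟨fun F hF => ?_, fun j => ?_⟩
      · rw [← h2]
        exact hv _ ((hval _).2 ((h1 F).trans hF))
      · have := hv (MvPolynomial.map MvPolynomial.C (Z j) - MvPolynomial.C (MvPolynomial.X j))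
          ((hval _).2 (by
            rw [MvPolynomial.eval₂_sub, h1, hZ, MvPolynomial.eval₂_C, hRLapply,
              MvPolynomial.aeval_X, sub_self]))
        rwa [MvPolynomial.eval₂_sub, h2, MvPolynomial.eval₂_C, MvPolynomial.eval_X,
          sub_eq_zero] at this

end GenericFibre

/-! ### The moment map of a toric model -/

section MomentMap

open Filter Topology

variable {d : ℕ} {ι : Type*} {a : ι → Fin d → ℤ} {w : ι → ℝ}

theorem IsToricData.nonempty (h : IsToricData a w) : Nonempty ι := by
  by_contra hι
  rw [not_nonempty_iff] at hι
  have := h.full_dim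
  rw [domainPolytope, Set.range_eq_empty, convexHull_empty, AffineSubspace.span_empty] at this
  exact bot_ne_top this

theorem weightedMonomials_pos (hw : ∀ i, 0 < w i) {x : Fin d → ℝ} (hx : ∀ j, 0 < x j) (i : ι) :
    0 < weightedMonomials a w x i :=
  mul_pos (hw i) (Finset.prod_pos fun j _ => zpow_pos (hx j) _)

theorem convex_domainPolytope (p : ι → Fin d → ℝ) : Convex ℝ (domainPolytope p) :=
  convex_convexHull ℝ _

theorem interior_domainPolytope_nonempty (h : IsToricData a w) :
    (interior (domainPolytope (realPoints a))).Nonempty :=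
  (convex_domainPolytope _).interior_nonempty_iff_affineSpan_eq_top.2 h.full_dim

theorem domainPolytope_subset_closure_interior (h : IsToricData a w) :
    domainPolytope (realPoints a) ⊆ closure (interior (domainPolytope (realPoints a))) := by
  rw [(convex_domainPolytope _).closure_interior_eq_closure_of_nonempty_interior
    (interior_domainPolytope_nonempty h)]
  exact subset_closure

/-- Linear forms grow on a polytope at least linearly, away from an interior point. -/
theorem exists_vertex_of_ball_subset {p : ι → Fin d → ℝ} {y : Fin d → ℝ} {r : ℝ} (hr : 0 < r)
    (hy : Metric.closedBall y r ⊆ domainPolytope p) (θ : Fin d → ℝ) :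
    ∃ i, r * ‖θ‖ ≤ ∑ j, θ j * (p i j - y j) := by
  classical
  -- Moving by `r` in each coordinate in the direction of the sign of `θ` stays in the sup-norm ball
  -- and increases the form by `r ∑ |θ_j|`. Some vertex does at least as well.
  let y' : Fin d → ℝ := fun j => y j + r * SignType.sign (θ j)
  have hy' : y' ∈ domainPolytope p := by
    apply hy
    rw [Metric.mem_closedBall, dist_pi_le_iff hr.le]
    intro j
    rw [Real.dist_eq]
    rcases lt_trichotomy (θ j) 0 with h | h | h <;> simp [y', h, abs_of_pos hr, hr.le]
  let f : (Fin d → ℝ) → ℝ := fun u => ∑ j, θ j * (u j - y j)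
  have hf : ConvexOn ℝ (convexHull ℝ (Set.range p)) f := by
    refine ⟨convex_convexHull _ _, fun u _ v _ s t _ _ hst => le_of_eq ?_⟩
    simp only [f, Pi.add_apply, Pi.smul_apply, smul_eq_mul, Finset.mul_sum,
      ← Finset.sum_add_distrib]
    refine Finset.sum_congr rfl fun j _ => ?_
    linear_combination (θ j * y j) * hst
  obtain ⟨_, ⟨i, rfl⟩, hi⟩ := hf.exists_ge_of_mem_convexHull (subset_convexHull ℝ _) hy'
  refine ⟨i, le_trans ?_ hi⟩
  have : f y' = r * ∑ j, |θ j| := by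
    simp only [f, y', add_sub_cancel_left, Finset.mul_sum]
    refine Finset.sum_congr rfl fun j _ => ?_
    rw [← self_mul_sign]
    ring
  rw [this]
  refine mul_le_mul_of_nonneg_left ?_ hr.le
  refine (pi_norm_le_iff_of_nonneg (Finset.sum_nonneg fun j _ => abs_nonneg _)).2 fun j => ?_
  exact Finset.single_le_sum (f := fun j => |θ j|) (fun j _ => abs_nonneg _) (Finset.mem_univ j)

variable [Fintype ι]

/-- The moment map `q ↦ ∑ q_i a_i`. -/
noncomputable def momentMap (a : ι → Fin d → ℤ) (q : ι → ℝ) : Fin d → ℝ :=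
  ∑ i, q i • realPoints a i

theorem momentMap_apply (a : ι → Fin d → ℤ) (q : ι → ℝ) (j : Fin d) :
    momentMap a q j = ∑ i, q i * a i j := by
  simp [momentMap, realPoints, Finset.sum_apply]

theorem continuous_momentMap (a : ι → Fin d → ℤ) : Continuous (momentMap a) := by
  unfold momentMap
  fun_prop

theorem prod_exp_zpow (θ : Fin d → ℝ) (b : Fin d → ℤ) :
    ∏ j, Real.exp (θ j) ^ b j = Real.exp (∑ j, θ j * b j) := by
  rw [Real.exp_sum]
  refine Finset.prod_congr rfl fun j _ => ?_
  rw [mul_comm, ← Real.rpow_intCast, ← Real.exp_mul, mul_comm]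

theorem sum_weightedMonomials_pos (h : IsToricData a w) {x : Fin d → ℝ} (hx : ∀ j, 0 < x j) :
    0 < ∑ i, weightedMonomials a w x i := by
  have := h.nonempty
  exact Finset.sum_pos (fun i _ => weightedMonomials_pos h.pos hx i) Finset.univ_nonempty

theorem modelProbability_pos (h : IsToricData a w) {x : Fin d → ℝ} (hx : ∀ j, 0 < x j) (i : ι) :
    0 < modelProbability a w i x :=
  div_pos (weightedMonomials_pos h.pos hx i) (sum_weightedMonomials_pos h hx)

theorem sum_modelProbability (h : IsToricData a w) {x : Fin d → ℝ} (hx : ∀ j, 0 < x j) :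
    ∑ i, modelProbability a w i x = 1 := by
  simp only [modelProbability]
  rw [← Finset.sum_div, div_self (sum_weightedMonomials_pos h hx).ne']

/-- Birch's theorem: the moment map takes every interior point of the polytope as value on the
toric model. -/
theorem exists_momentMap_eq_of_mem_interior (h : IsToricData a w) {y : Fin d → ℝ}
    (hy : y ∈ interior (domainPolytope (realPoints a))) :
    ∃ x : Fin d → ℝ, (∀ j, 0 < x j) ∧ momentMap a (fun i => modelProbability a w i x) = y := by
  classical
  have := h.nonempty
  obtain ⟨r, hr, hball⟩ : ∃ r > 0, Metric.closedBall y r ⊆ domainPolytope (realPoints a) :=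
    Metric.nhds_basis_closedBall.mem_iff.1 (mem_interior_iff_mem_nhds.1 hy)
  -- The gradient of `f(θ) = ∑ w_i exp ⟨θ, a_i - y⟩` vanishes exactly if the model point with
  -- parameter `x = exp θ` has moments `y`. Since `y` is interior, `f` is coercive and has a
  -- minimum.
  let c : ι → Fin d → ℝ := fun i j => realPoints a i j - y j
  let f : (Fin d → ℝ) → ℝ := fun θ => ∑ i, w i * Real.exp (∑ j, θ j * c i j)
  have hcont : Continuous f := by fun_prop
  obtain ⟨i₀, hi₀⟩ := Finite.exists_min w
  have hbound : ∀ θ, w i₀ * (r * ‖θ‖) ≤ f θ := by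
    intro θ
    obtain ⟨i, hi⟩ := exists_vertex_of_ball_subset hr hball θ
    calc w i₀ * (r * ‖θ‖) ≤ w i * Real.exp (∑ j, θ j * c i j) := by
          refine mul_le_mul (hi₀ i) ?_ (by positivity) (h.pos i).le
          exact hi.trans ((le_add_of_nonneg_right zero_le_one).trans (Real.add_one_le_exp _))
      _ ≤ f θ := Finset.single_le_sum (f := fun i => w i * Real.exp (∑ j, θ j * c i j))
          (fun i _ => mul_nonneg (h.pos i).le (Real.exp_pos _).le) (Finset.mem_univ i)
  have htend : Tendsto f (cocompact _) atTop := by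
    refine tendsto_atTop_mono hbound ?_
    exact ((tendsto_norm_cocompact_atTop (E := Fin d → ℝ)).const_mul_atTop hr).const_mul_atTop
      (h.pos i₀)
  obtain ⟨θ, hθ⟩ := hcont.exists_forall_le htend
  have hgrad : ∀ j, ∑ i, w i * (Real.exp (∑ l, θ l * c i l) * c i j) = 0 := by
    intro j
    let g : ℝ → ℝ := fun t => ∑ i, w i * Real.exp (∑ l, θ l * c i l + t * c i j)
    have hg : ∀ t, g t = f (θ + t • Pi.single j 1) := by
      intro t
      refine Finset.sum_congr rfl fun i _ => ?_
      congr 2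
      simp [add_mul, Finset.sum_add_distrib, Pi.single_apply]
    have hmin : IsLocalMin g 0 := by
      refine Eventually.of_forall fun t => ?_
      rw [hg, hg]
      simpa using hθ _
    have hder : HasDerivAt g (∑ i, w i * (Real.exp (∑ l, θ l * c i l) * c i j)) 0 := by
      refine HasDerivAt.fun_sum fun i _ => HasDerivAt.const_mul _ ?_
      have h1 : HasDerivAt (fun t : ℝ => ∑ l, θ l * c i l + t * c i j) (c i j) 0 := by
        simpa using ((hasDerivAt_id (0 : ℝ)).mul_const (c i j)).const_add (∑ l, θ l * c i l)
      simpa using h1.exp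
    exact hmin.hasDerivAt_eq_zero hder
  have hx : ∀ j, 0 < Real.exp (θ j) := fun j => Real.exp_pos _
  refine ⟨fun j => Real.exp (θ j), hx, ?_⟩
  have hZ := sum_weightedMonomials_pos h hx
  have hterm : ∀ i, w i * Real.exp (∑ l, θ l * c i l) =
      weightedMonomials a w (fun j => Real.exp (θ j)) i * Real.exp (-∑ l, θ l * y l) := by
    intro i
    rw [weightedMonomials, prod_exp_zpow, mul_assoc, ← Real.exp_add]
    simp only [c, realPoints, mul_sub, Finset.sum_sub_distrib, ← sub_eq_add_neg]
  funext j
  rw [momentMap_apply]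
  have h1 : ∑ i, weightedMonomials a w (fun j => Real.exp (θ j)) i * ((a i j : ℝ) - y j) = 0 := by
    have h2 := hgrad j
    simp_rw [← mul_assoc, hterm, mul_right_comm _ (Real.exp _), ← Finset.sum_mul] at h2
    exact (mul_eq_zero.1 h2).resolve_right (Real.exp_pos _).ne'
  simp_rw [mul_sub, Finset.sum_sub_distrib, ← Finset.sum_mul] at h1
  simp_rw [modelProbability, div_mul_eq_mul_div]
  rw [← Finset.sum_div, div_eq_iff hZ.ne', mul_comm]
  linarith

theorem toricModel_subset_stdSimplex (h : IsToricData a w) : toricModel a w ⊆ stdSimplex ℝ ι := by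
  rintro _ ⟨x, hx, rfl⟩
  exact ⟨fun i => (modelProbability_pos h hx i).le, sum_modelProbability h hx⟩

theorem closure_toricModel_subset_stdSimplex (h : IsToricData a w) :
    closure (toricModel a w) ⊆ stdSimplex ℝ ι :=
  closure_minimal (toricModel_subset_stdSimplex h) (isClosed_stdSimplex ℝ ι)

theorem isCompact_closure_toricModel (h : IsToricData a w) :
    IsCompact (closure (toricModel a w)) :=
  (isCompact_stdSimplex ℝ ι).of_isClosed_subset isClosed_closure
    (closure_toricModel_subset_stdSimplex h)

theorem momentMap_mem_domainPolytope {q : ι → ℝ} (hq : q ∈ stdSimplex ℝ ι) :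
    momentMap a q ∈ domainPolytope (realPoints a) :=
  (convex_convexHull ℝ _).sum_mem (fun i _ => hq.1 i) hq.2
    fun i _ => subset_convexHull ℝ _ ⟨i, rfl⟩

/-- On the toric model, `log (p / w)` is an affine function of the exponents. -/
theorem sum_sub_mul_log_eq_zero (h : IsToricData a w) {p q q' : ι → ℝ} (hp : p ∈ toricModel a w)
    (hsum : ∑ i, q i = ∑ i, q' i) (hmom : momentMap a q = momentMap a q') :
    ∑ i, (q i - q' i) * Real.log (p i / w i) = 0 := by
  obtain ⟨x, hx, rfl⟩ := hp
  have hZ := sum_weightedMonomials_pos h hx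
  have hlog : ∀ i, Real.log (modelProbability a w i x / w i) =
      ∑ j, (a i j : ℝ) * Real.log (x j) - Real.log (∑ k, weightedMonomials a w x k) := by
    intro i
    have hprod : (0 : ℝ) < ∏ j, x j ^ a i j := Finset.prod_pos fun j _ => zpow_pos (hx j) _
    have : modelProbability a w i x / w i =
        (∏ j, x j ^ a i j) / ∑ k, weightedMonomials a w x k := by
      have := (h.pos i).ne'
      rw [modelProbability, weightedMonomials]
      field_simp
    rw [this, Real.log_div hprod.ne' hZ.ne', Real.log_prod fun j _ => (zpow_pos (hx j) _).ne']
    simp [Real.log_zpow]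
  simp_rw [hlog, mul_sub, Finset.sum_sub_distrib, Finset.mul_sum]
  rw [Finset.sum_comm, ← Finset.sum_mul, Finset.sum_sub_distrib, hsum, sub_self, zero_mul, sub_zero]
  refine Finset.sum_eq_zero fun j _ => ?_
  have hj := congrFun hmom j
  rw [momentMap_apply, momentMap_apply] at hj
  simp_rw [← mul_assoc]
  rw [← Finset.sum_mul]
  simp_rw [sub_mul]
  rw [Finset.sum_sub_distrib, hj, sub_self, zero_mul]

/-- Take the limit `p → q` in `sum_sub_mul_log_eq_zero`. If `q_k = 0 < q'_k`, the `q'`-weighted sum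
of logarithms would tend to `-∞` while the equal `q`-weighted sum converges. So the zeros of `q` are
zeros of `q'`, and the divergent terms have coefficient zero. -/
theorem eq_zero_and_sum_log_of_mem_closure (h : IsToricData a w) {q q' : ι → ℝ}
    (hq : q ∈ closure (toricModel a w)) (hq' : q' ∈ stdSimplex ℝ ι)
    (hmom : momentMap a q = momentMap a q') :
    (∀ i, q i = 0 → q' i = 0) ∧ ∑ i, (q i - q' i) * Real.log (q i / w i) = 0 := by
  classical
  have hqs := closure_toricModel_subset_stdSimplex h hq
  have hsum : ∑ i, q i = ∑ i, q' i := hqs.2.trans hq'.2.symm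
  have hne : (𝓝[toricModel a w] q).NeBot := mem_closure_iff_nhdsWithin_neBot.1 hq
  have hcoord : ∀ i, Tendsto (fun p : ι → ℝ => p i) (𝓝[toricModel a w] q) (𝓝 (q i)) := fun i =>
    ((continuous_apply i).tendsto q).mono_left nhdsWithin_le_nhds
  have hlogt : ∀ i, q i ≠ 0 → Tendsto (fun p : ι → ℝ => Real.log (p i / w i))
      (𝓝[toricModel a w] q) (𝓝 (Real.log (q i / w i))) := fun i hi =>
    ((hcoord i).div_const _).log (div_ne_zero hi (h.pos i).ne')
  have hev : ∀ᶠ p in 𝓝[toricModel a w] q, p ∈ toricModel a w := self_mem_nhdsWithin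
  have hzero : ∀ i, q i = 0 → q' i = 0 := by
    intro k hk
    by_contra hk'
    have hpos : 0 < q' k := lt_of_le_of_ne (hq'.1 k) (Ne.symm hk')
    have hL : Tendsto (fun p : ι → ℝ => ∑ i, q i * Real.log (p i / w i)) (𝓝[toricModel a w] q)
        (𝓝 (∑ i, q i * Real.log (q i / w i))) := by
      refine tendsto_finsetSum _ fun i _ => ?_
      by_cases hi : q i = 0
      · simp [hi]
      · exact (hlogt i hi).const_mul _
    have hk0 : Tendsto (fun p : ι → ℝ => p k / w k) (𝓝[toricModel a w] q) (𝓝[>] 0) := by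
      refine tendsto_nhdsWithin_iff.2 ⟨by simpa [hk] using (hcoord k).div_const (w k), ?_⟩
      filter_upwards [hev] with p hp
      obtain ⟨x, hx, rfl⟩ := hp
      exact div_pos (modelProbability_pos h hx k) (h.pos k)
    have hbot : Tendsto (fun p : ι → ℝ => q' k * Real.log (p k / w k)) (𝓝[toricModel a w] q)
        atBot := (Real.tendsto_log_nhdsGT_zero.comp hk0).const_mul_atBot hpos
    have hbot' : Tendsto (fun p : ι → ℝ => q' k * Real.log (p k / w k) +
        ∑ i ∈ Finset.univ.erase k, q' i * Real.log (1 / w i)) (𝓝[toricModel a w] q) atBot :=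
      tendsto_atBot_add_const_right _ _ hbot
    -- All terms but the `k`-th are bounded above because `p_i ≤ 1`.
    have hle : ∀ᶠ p in 𝓝[toricModel a w] q, ∑ i, q i * Real.log (p i / w i) ≤
        q' k * Real.log (p k / w k) +
          ∑ i ∈ Finset.univ.erase k, q' i * Real.log (1 / w i) := by
      filter_upwards [hev] with p hp
      have h0 := sum_sub_mul_log_eq_zero h hp hsum hmom
      simp_rw [sub_mul, Finset.sum_sub_distrib] at h0
      rw [sub_eq_zero.1 h0, ← Finset.add_sum_erase _ _ (Finset.mem_univ k)]
      refine add_le_add le_rfl (Finset.sum_le_sum fun i _ => ?_)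
      refine mul_le_mul_of_nonneg_left ?_ (hq'.1 i)
      have hps := toricModel_subset_stdSimplex h hp
      have hp0 : 0 < p i := by
        obtain ⟨x, hx, rfl⟩ := hp
        exact modelProbability_pos h hx i
      refine Real.log_le_log (div_pos hp0 (h.pos i)) (div_le_div_of_nonneg_right ?_ (h.pos i).le)
      rw [← hps.2]
      exact Finset.single_le_sum (fun i _ => hps.1 i) (Finset.mem_univ i)
    exact not_tendsto_nhds_of_tendsto_atBot (tendsto_atBot_mono' _ hle hbot') _ hL
  refine ⟨hzero, ?_⟩
  have hL : Tendsto (fun p : ι → ℝ => ∑ i, (q i - q' i) * Real.log (p i / w i))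
      (𝓝[toricModel a w] q) (𝓝 (∑ i, (q i - q' i) * Real.log (q i / w i))) := by
    refine tendsto_finsetSum _ fun i _ => ?_
    by_cases hi : q i = 0
    · simp [hi, hzero i hi]
    · exact (hlogt i hi).const_mul _
  have hL0 : Tendsto (fun p : ι → ℝ => ∑ i, (q i - q' i) * Real.log (p i / w i))
      (𝓝[toricModel a w] q) (𝓝 0) := by
    refine tendsto_const_nhds.congr' ?_
    filter_upwards [hev] with p hp
    exact (sum_sub_mul_log_eq_zero h hp hsum hmom).symm
  exact tendsto_nhds_unique hL hL0

/-- Adding the relations for `(q, q')` and `(q', q)` gives a symmetrized relative entropy equal to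
zero. Its terms are non-negative, and positive where `q` and `q'` differ, as the logarithm is
increasing and the two points have the same zeros. -/
theorem injOn_momentMap (h : IsToricData a w) :
    Set.InjOn (momentMap a) (closure (toricModel a w)) := by
  intro q hq q' hq' hmom
  have hqs := closure_toricModel_subset_stdSimplex h hq
  have hqs' := closure_toricModel_subset_stdSimplex h hq'
  obtain ⟨h1, h2⟩ := eq_zero_and_sum_log_of_mem_closure h hq hqs' hmom
  obtain ⟨h1', h2'⟩ := eq_zero_and_sum_log_of_mem_closure h hq' hqs hmom.symm
  have hsum : ∑ i, (q i - q' i) * (Real.log (q i / w i) - Real.log (q' i / w i)) = 0 := by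
    have : ∀ i, (q i - q' i) * (Real.log (q i / w i) - Real.log (q' i / w i)) =
        (q i - q' i) * Real.log (q i / w i) + (q' i - q i) * Real.log (q' i / w i) :=
      fun i => by ring
    rw [Finset.sum_congr rfl fun i _ => this i, Finset.sum_add_distrib, h2, h2', add_zero]
  have hpos : ∀ i, q i ≠ q' i →
      0 < (q i - q' i) * (Real.log (q i / w i) - Real.log (q' i / w i)) := by
    intro i hi
    have hw := h.pos i
    have hqi : 0 < q i := lt_of_le_of_ne (hqs.1 i) fun h0 =>
      hi (by rw [h1 i h0.symm, ← h0])
    have hqi' : 0 < q' i := lt_of_le_of_ne (hqs'.1 i) fun h0 =>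
      hi (by rw [h1' i h0.symm, ← h0])
    rcases lt_or_gt_of_ne hi with hlt | hlt
    · have := Real.log_lt_log (div_pos hqi hw) (div_lt_div_of_pos_right hlt hw)
      exact mul_pos_of_neg_of_neg (sub_neg.2 hlt) (sub_neg.2 this)
    · have := Real.log_lt_log (div_pos hqi' hw) (div_lt_div_of_pos_right hlt hw)
      exact mul_pos (sub_pos.2 hlt) (sub_pos.2 this)
  funext i
  by_contra hi
  refine hi ?_
  have hnn : ∀ i ∈ Finset.univ,
      0 ≤ (q i - q' i) * (Real.log (q i / w i) - Real.log (q' i / w i)) := by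
    intro i _
    by_cases hi : q i = q' i
    · simp [hi]
    · exact (hpos i hi).le
  exact absurd ((Finset.sum_eq_zero_iff_of_nonneg hnn).1 hsum i (Finset.mem_univ i))
    (hpos i hi).ne'

/-- The image is closed by compactness and contains the interior of `Δ` by Birch's theorem; the
interior is dense in `Δ`. -/
theorem image_momentMap (h : IsToricData a w) :
    momentMap a '' closure (toricModel a w) = domainPolytope (realPoints a) := by
  refine Set.Subset.antisymm ?_ ?_
  · rintro _ ⟨q, hq, rfl⟩
    exact momentMap_mem_domainPolytope (closure_toricModel_subset_stdSimplex h hq)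
  · refine (domainPolytope_subset_closure_interior h).trans (closure_minimal ?_
      ((isCompact_closure_toricModel h).image (continuous_momentMap a)).isClosed)
    intro y hy
    obtain ⟨x, hx, e⟩ := exists_momentMap_eq_of_mem_interior h hy
    exact ⟨_, subset_closure ⟨x, hx, rfl⟩, e⟩

/-- The inverse of the moment map: a continuous parametrization of `X_{a,w}` by the polytope. -/
theorem exists_momentMap_inverse (h : IsToricData a w) :
    ∃ ν : domainPolytope (realPoints a) → ι → ℝ, Continuous ν ∧
      Set.range ν = closure (toricModel a w) ∧ (∀ y, momentMap a (ν y) = y) ∧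
      ∀ q ∈ closure (toricModel a w), ∀ y : domainPolytope (realPoints a),
        momentMap a q = y → ν y = q := by
  have hX : CompactSpace (closure (toricModel a w)) :=
    isCompact_iff_compactSpace.1 (isCompact_closure_toricModel h)
  have hmaps : ∀ q : closure (toricModel a w), momentMap a q ∈ domainPolytope (realPoints a) :=
    fun q => (image_momentMap h).subset ⟨q, q.2, rfl⟩
  let m : closure (toricModel a w) → domainPolytope (realPoints a) :=
    fun q => ⟨momentMap a q, hmaps q⟩
  have hm : Continuous m :=
    ((continuous_momentMap a).comp continuous_subtype_val).subtype_mk hmaps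
  have hbij : Function.Bijective m := by
    refine ⟨fun q q' e => Subtype.ext (injOn_momentMap h q.2 q'.2 (congrArg Subtype.val e)),
      fun y => ?_⟩
    obtain ⟨q, hq, e⟩ := (image_momentMap h).superset y.2
    exact ⟨⟨q, hq⟩, Subtype.ext e⟩
  let E : closure (toricModel a w) ≃ₜ domainPolytope (realPoints a) :=
    Continuous.homeoOfEquivCompactToT2 (f := Equiv.ofBijective m hbij) hm
  have hE : ∀ q, E q = m q := fun q => rfl
  refine ⟨fun y => (E.symm y : ι → ℝ), continuous_subtype_val.comp E.symm.continuous, ?_, ?_, ?_⟩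
  · rw [show (fun y => (E.symm y : ι → ℝ)) = Subtype.val ∘ E.symm from rfl,
      E.symm.surjective.range_comp, Subtype.range_coe]
  · intro y
    exact congrArg Subtype.val (E.apply_symm_apply y)
  · intro q hq y e
    have : E ⟨q, hq⟩ = y := Subtype.ext e
    exact congrArg Subtype.val (E.symm_apply_eq.2 this.symm)

/-- Affine functions are replicated as soon as the moments are. -/
theorem affineMap_eq_sum_of_momentMap_eq {q : ι → ℝ} (hq : ∑ i, q i = 1) {x : Fin d → ℝ}
    (hx : momentMap a q = x) (L : (Fin d → ℝ) →ᵃ[ℝ] ℝ) :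
    L x = ∑ i, q i * L (realPoints a i) := by
  have hL : ∀ u, L u = L.linear u + L 0 := fun u => by
    have := congrFun L.decomp u
    simpa using this
  rw [← hx, hL, momentMap, map_sum]
  simp_rw [hL (realPoints a _), mul_add, Finset.sum_add_distrib, ← Finset.sum_mul, hq, map_smul,
    one_mul, smul_eq_mul]

end MomentMap

/-! ### Rational linear precision in terms of the moment map -/

namespace ParametricPatch

variable {d : ℕ} {ι : Type*} [Fintype ι] {a : ι → Fin d → ℤ} {w : ι → ℝ}

theorem sum_blend_pos {p : ι → Fin d → ℝ} (β : ParametricPatch p) (x : domainPolytope p) :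
    0 < ∑ i, β.blend i x := by
  obtain ⟨i, hi⟩ := β.no_base_point x
  exact Finset.sum_pos' (fun i _ => β.nonneg i x)
    ⟨i, Finset.mem_univ i, lt_of_le_of_ne (β.nonneg i x) (Ne.symm hi)⟩

theorem sum_normalized {p : ι → Fin d → ℝ} (β : ParametricPatch p) (x : domainPolytope p) :
    ∑ i, β.normalized i x = 1 := by
  simp only [normalized]
  rw [← Finset.sum_div, div_self (β.sum_blend_pos x).ne']

theorem continuous_toSimplex {p : ι → Fin d → ℝ} (β : ParametricPatch p) :
    Continuous β.toSimplex :=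
  continuous_pi fun i => (β.continuous_blend i).div
    (continuous_finsetSum _ fun i _ => β.continuous_blend i) fun x => (β.sum_blend_pos x).ne'

theorem HasLinearPrecision.momentMap_eq {β : ParametricPatch (realPoints a)}
    (h : β.HasLinearPrecision) (x : domainPolytope (realPoints a)) :
    momentMap a (β.toSimplex x) = x := by
  funext j
  have := h (LinearMap.proj (R := ℝ) (φ := fun _ : Fin d => ℝ) j).toAffineMap x
  rw [momentMap_apply]
  exact this.symm

/-- A patch is determined by an inverse of the moment map. -/
theorem exists_isToric_of_inverse (h : IsToricData a w)
    {ν : domainPolytope (realPoints a) → ι → ℝ} (hν : Continuous ν)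
    (hr : Set.range ν = closure (toricModel a w)) :
    ∃ β : ParametricPatch (realPoints a), β.IsToric a w ∧ β.toSimplex = ν := by
  have hs : ∀ y, ν y ∈ stdSimplex ℝ ι := fun y =>
    closure_toricModel_subset_stdSimplex h (hr.subset ⟨y, rfl⟩)
  let β : ParametricPatch (realPoints a) :=
    { blend := fun i y => ν y i
      continuous_blend := fun i => (continuous_apply i).comp hν
      nonneg := fun i y => (hs y).1 i
      no_base_point := fun y => by
        by_contra! h0
        have := (hs y).2
        simp [h0] at this }
  have hβ : β.toSimplex = ν := by
    funext y i
    change ν y i / ∑ k, ν y k = ν y i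
    rw [(hs y).2, div_one]
  exact ⟨β, by rw [IsToric, hβ, hr], hβ⟩

/-- Linear precision makes the reparametrized patch a section of the moment map with values in `X`,
so it coincides with `ν`. -/
theorem HasRationalLinearPrecision.isRationalFunction_inverse
    {ν : domainPolytope (realPoints a) → ι → ℝ}
    (hν : ∀ q ∈ closure (toricModel a w), ∀ y : domainPolytope (realPoints a),
      momentMap a q = y → ν y = q)
    {β : ParametricPatch (realPoints a)} (hβ : β.IsToric a w) (h : β.HasRationalLinearPrecision)
    (i : ι) : IsRationalFunction (p := realPoints a) fun y => ν y i := by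
  obtain ⟨-, ψ, hlin, hrat⟩ := h
  convert hrat i using 1
  funext y
  exact congrFun (hν _ (hβ.subset ⟨ψ y, rfl⟩) y (hlin.momentMap_eq y)) i

/-- The tautological map is the moment map after `toSimplex`: injective because both factors are,
surjective because the patch passes through every `ν y`. By compactness it is a homeomorphism, and
its inverse reparametrizes the patch to `ν`. -/
theorem hasRationalLinearPrecision_of_inverse (h : IsToricData a w)
    {ν : domainPolytope (realPoints a) → ι → ℝ}
    (hr : Set.range ν = closure (toricModel a w)) (hm : ∀ y, momentMap a (ν y) = y)
    (hν : ∀ q ∈ closure (toricModel a w), ∀ y : domainPolytope (realPoints a),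
      momentMap a q = y → ν y = q)
    (hrat : ∀ i, IsRationalFunction (p := realPoints a) fun y => ν y i)
    {β : ParametricPatch (realPoints a)} (hβ : β.IsToric a w)
    (hinj : Function.Injective β.toSimplex) : β.HasRationalLinearPrecision := by
  have : CompactSpace (domainPolytope (realPoints a)) :=
    isCompact_iff_compactSpace.1 ((Set.finite_range _).isCompact_convexHull ℝ)
  have hX : ∀ x, β.toSimplex x ∈ closure (toricModel a w) := fun x => hβ.subset ⟨x, rfl⟩
  have hmaps : ∀ x, β.tautologicalMap x ∈ domainPolytope (realPoints a) := fun x =>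
    momentMap_mem_domainPolytope (closure_toricModel_subset_stdSimplex h (hX x))
  let m : domainPolytope (realPoints a) → domainPolytope (realPoints a) :=
    fun x => ⟨β.tautologicalMap x, hmaps x⟩
  have hcont : Continuous m :=
    ((continuous_momentMap a).comp β.continuous_toSimplex).subtype_mk hmaps
  have hbij : Function.Bijective m := by
    refine ⟨fun x x' e => hinj (injOn_momentMap h (hX x) (hX x') (congrArg Subtype.val e)),
      fun y => ?_⟩
    obtain ⟨x, hx⟩ : ν y ∈ Set.range β.toSimplex := by
      rw [hβ, ← hr]
      exact ⟨y, rfl⟩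
    exact ⟨x, Subtype.ext (by rw [← hm y, ← hx]; rfl)⟩
  let e : domainPolytope (realPoints a) ≃ₜ domainPolytope (realPoints a) :=
    Continuous.homeoOfEquivCompactToT2 (f := Equiv.ofBijective m hbij) hcont
  have he : ∀ y, momentMap a (β.toSimplex (e.symm y)) = y := fun y =>
    congrArg Subtype.val (e.apply_symm_apply y)
  refine ⟨⟨e, fun x => rfl⟩, e.symm, fun L y => ?_, fun i => ?_⟩
  · exact affineMap_eq_sum_of_momentMap_eq (sum_normalized _ _) (he y) L
  · convert hrat i using 1
    funext y
    exact (congrFun (hν _ (hX (e.symm y)) y (he y)) i).symm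

end ParametricPatch

/-! ### The affine cone over the toric variety -/

section GenericPoint

open MvPolynomial

variable {n : ℕ} {ι : Type*}

theorem weightedMonomials_ne_zero {K : Type*} [Field K] {b : ι → Fin n → ℤ} {w : ι → K}
    (hw : ∀ i, w i ≠ 0) {s : Fin n → K} (hs : ∀ j, s j ≠ 0) (i : ι) :
    weightedMonomials b w s i ≠ 0 :=
  mul_ne_zero (hw i) (Finset.prod_ne_zero_iff.2 fun j _ => zpow_ne_zero _ (hs j))

/-- Polynomials in Laurent monomials become polynomials after clearing denominators. -/
theorem exists_clear_laurent (b : ι → Fin n → ℤ) (w : ι → ℂ) (F : MvPolynomial ι ℂ) :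
    ∃ (D : ℕ) (p : MvPolynomial (Fin n) ℂ), ∀ (K : Type) [Field K] [Algebra ℂ K] (s : Fin n → K),
      (∀ j, s j ≠ 0) → (∏ j, s j) ^ D *
        aeval (weightedMonomials b (fun i => algebraMap ℂ K (w i)) s) F = aeval s p := by
  induction F using MvPolynomial.induction_on with
  | C r => exact ⟨0, C r, fun K _ _ s _ => by simp⟩
  | add F F' h h' =>
    obtain ⟨D, p, e⟩ := h
    obtain ⟨D', p', e'⟩ := h'
    refine ⟨D + D', (∏ j, X j) ^ D' * p + (∏ j, X j) ^ D * p', fun K _ _ s hs => ?_⟩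
    simp only [map_add, map_mul, map_pow, map_prod, aeval_X, ← e K s hs, ← e' K s hs]
    ring
  | mul_X F i h =>
    obtain ⟨D, p, e⟩ := h
    -- A crude bound for all exponents of the monomial, so that `b i j + E` is never negative.
    let E : ℕ := ∑ j, (b i j).natAbs
    have hE : ∀ j, 0 ≤ b i j + E := by
      intro j
      have : (b i j).natAbs ≤ E :=
        Finset.single_le_sum (f := fun j => (b i j).natAbs) (fun _ _ => Nat.zero_le _)
          (Finset.mem_univ j)
      lia
    refine ⟨D + E, p * (C (w i) * ∏ j, X j ^ (b i j + E).toNat), fun K _ _ s hs => ?_⟩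
    have hmon : (∏ j, s j) ^ E * ∏ j, s j ^ b i j = ∏ j, s j ^ (b i j + E).toNat := by
      rw [← Finset.prod_pow, ← Finset.prod_mul_distrib]
      refine Finset.prod_congr rfl fun j _ => ?_
      rw [← zpow_natCast (s j) (b i j + E).toNat, Int.toNat_of_nonneg (hE j), zpow_add₀ (hs j),
        zpow_natCast, mul_comm]
    simp only [map_mul, map_prod, map_pow, aeval_X, algHom_C, ← e K s hs, ← hmon,
      weightedMonomials]
    ring

/-- The generic point of a monomially parametrized variety. -/
noncomputable def monomialGenericPoint (b : ι → Fin n → ℤ) (w : ι → ℂ) :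
    ι → FractionRing (MvPolynomial (Fin n) ℂ) :=
  weightedMonomials b (fun i => algebraMap ℂ _ (w i))
    (fun j => algebraMap (MvPolynomial (Fin n) ℂ) _ (X j))

/-- The cleared polynomial `p` is the same over `ℂ` and over the function field. This lets relations
of the generic point be tested at numerical points. -/
theorem aeval_monomialGenericPoint_eq_zero_iff {b : ι → Fin n → ℤ} {w : ι → ℂ} {F : MvPolynomial ι ℂ}
    {D : ℕ} {p : MvPolynomial (Fin n) ℂ}
    (h : ∀ (K : Type) [Field K] [Algebra ℂ K] (s : Fin n → K),
      (∀ j, s j ≠ 0) → (∏ j, s j) ^ D *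
        aeval (weightedMonomials b (fun i => algebraMap ℂ K (w i)) s) F = aeval s p) :
    aeval (monomialGenericPoint b w) F = 0 ↔ p = 0 := by
  have hinj := IsFractionRing.injective (MvPolynomial (Fin n) ℂ)
    (FractionRing (MvPolynomial (Fin n) ℂ))
  have hX : ∀ j : Fin n, algebraMap (MvPolynomial (Fin n) ℂ)
      (FractionRing (MvPolynomial (Fin n) ℂ)) (X j) ≠ 0 := fun j => by
    simp
  have h1 := h (FractionRing (MvPolynomial (Fin n) ℂ)) (fun j => algebraMap _ _ (X j)) hX
  have h2 : aeval (fun j : Fin n => algebraMap (MvPolynomial (Fin n) ℂ)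
      (FractionRing (MvPolynomial (Fin n) ℂ)) (X j)) p = algebraMap _ _ p := by
    exact (aeval_algebraMap_apply _ X p).trans (by rw [aeval_X_left_apply])
  rw [h2] at h1
  constructor
  · intro h0
    rw [monomialGenericPoint] at h0
    rw [h0, mul_zero] at h1
    exact hinj (by rw [← h1, map_zero])
  · intro h0
    rw [h0, map_zero] at h1
    exact (mul_eq_zero.1 h1).resolve_left
      (pow_ne_zero _ (Finset.prod_ne_zero_iff.2 fun j _ => hX j))

theorem eval_eq_zero_of_aeval_monomialGenericPoint {b : ι → Fin n → ℤ} {w : ι → ℂ} {F : MvPolynomial ι ℂ}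
    (h : aeval (monomialGenericPoint b w) F = 0) {s : Fin n → ℂ} (hs : ∀ j, s j ≠ 0) :
    eval (weightedMonomials b w s) F = 0 := by
  obtain ⟨D, p, e⟩ := exists_clear_laurent b w F
  rw [aeval_monomialGenericPoint_eq_zero_iff e] at h
  have h1 := e ℂ s hs
  rw [h, map_zero] at h1
  exact (mul_eq_zero.1 h1).resolve_left (pow_ne_zero _ (Finset.prod_ne_zero_iff.2 fun j _ => hs j))

/-- A product of infinite sets is Zariski dense, in particular the real positive orthant. Algebraic
identities can thus be checked on the statistical model. -/
theorem aeval_monomialGenericPoint_eq_zero_of_pos {b : ι → Fin n → ℤ} {w : ι → ℂ} {F : MvPolynomial ι ℂ}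
    (h : ∀ s : Fin n → ℝ, (∀ j, 0 < s j) →
      eval (weightedMonomials b w fun j => (s j : ℂ)) F = 0) :
    aeval (monomialGenericPoint b w) F = 0 := by
  obtain ⟨D, p, e⟩ := exists_clear_laurent b w F
  rw [aeval_monomialGenericPoint_eq_zero_iff e]
  refine MvPolynomial.funext_set (fun _ => Complex.ofReal '' Set.Ioi 0) (fun _ =>
    (Set.Ioi_infinite 0).image Complex.ofReal_injective.injOn) fun x hx => ?_
  choose s hs hsx using fun j => hx j (Set.mem_univ j)
  obtain rfl : (fun j => (s j : ℂ)) = x := funext hsx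
  have h1 := e ℂ (fun j => (s j : ℂ)) fun j => Complex.ofReal_ne_zero.2 (hs j).ne'
  have h2 : aeval (weightedMonomials b (fun i => algebraMap ℂ ℂ (w i)) fun j => (s j : ℂ)) F = 0 :=
    h s hs
  rw [h2, mul_zero] at h1
  rw [map_zero]
  exact h1.symm

theorem aeval_monomialGenericPoint_eq_zero {b : ι → Fin n → ℤ} {w : ι → ℂ} {F : MvPolynomial ι ℂ} :
    aeval (monomialGenericPoint b w) F = 0 ↔
      ∀ s : Fin n → ℂ, (∀ j, s j ≠ 0) → eval (weightedMonomials b w s) F = 0 :=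
  ⟨fun h _ hs => eval_eq_zero_of_aeval_monomialGenericPoint h hs, fun h =>
    aeval_monomialGenericPoint_eq_zero_of_pos fun s hs =>
      h (fun j => (s j : ℂ)) fun j => Complex.ofReal_ne_zero.2 (hs j).ne'⟩

theorem trdeg_fractionRing_mvPolynomial :
    Algebra.trdeg ℂ (FractionRing (MvPolynomial (Fin n) ℂ)) = n := by
  rw [← trdeg_add_eq ℂ (MvPolynomial (Fin n) ℂ), MvPolynomial.trdeg_of_isDomain,
    trdeg_eq_zero_iff.2 (IsLocalization.isAlgebraic _
      (nonZeroDivisors (MvPolynomial (Fin n) ℂ))), add_zero]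
  simp

end GenericPoint

/-! ### Binomial equations: the points of the cone inside and outside the torus. -/

section Binomial

open MvPolynomial

variable {n : ℕ} {ι : Type*}

/-- The closed cone of the points at which all polynomials vanish that vanish on the monomially
parametrized torus. -/
def monomialCone (b : ι → Fin n → ℤ) (w : ι → ℂ) : Set (ι → ℂ) :=
  {v | ∀ F : MvPolynomial ι ℂ, (∀ s : Fin n → ℂ, (∀ j, s j ≠ 0) →
    eval (weightedMonomials b w s) F = 0) → eval v F = 0}

theorem weightedMonomials_mem_monomialCone {b : ι → Fin n → ℤ} {w : ι → ℂ} {s : Fin n → ℂ}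
    (hs : ∀ j, s j ≠ 0) : weightedMonomials b w s ∈ monomialCone b w := fun _ hF => hF s hs

variable [Fintype ι]

/-- Both monomials pull back to the same Laurent monomial on the torus, so their difference is one
of the equations of the cone. -/
theorem prod_div_pow_eq_of_mem_monomialCone {b : ι → Fin n → ℤ} {w : ι → ℂ} (hw : ∀ i, w i ≠ 0)
    {v : ι → ℂ} (hv : v ∈ monomialCone b w) {p q : ι → ℕ}
    (hpq : ∀ j, ∑ i, (p i : ℤ) * b i j = ∑ i, (q i : ℤ) * b i j) :
    ∏ i, (v i / w i) ^ p i = ∏ i, (v i / w i) ^ q i := by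
  have key : ∀ (r : ι → ℕ) (s : Fin n → ℂ), (∀ j, s j ≠ 0) →
      ∏ i, ((w i)⁻¹ * weightedMonomials b w s i) ^ r i =
        ∏ j, s j ^ (∑ i, (r i : ℤ) * b i j) := by
    intro r s hs
    have : ∀ i, ((w i)⁻¹ * weightedMonomials b w s i) ^ r i = ∏ j, s j ^ ((r i : ℤ) * b i j) := by
      intro i
      rw [weightedMonomials, inv_mul_cancel_left₀ (hw i), ← Finset.prod_pow]
      refine Finset.prod_congr rfl fun j _ => ?_
      rw [mul_comm, zpow_mul, zpow_natCast]
    rw [Finset.prod_congr rfl fun i _ => this i, Finset.prod_comm]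
    refine Finset.prod_congr rfl fun j _ => ?_
    induction (Finset.univ : Finset ι) using Finset.cons_induction with
    | empty => simp
    | cons i t hi ih => rw [Finset.prod_cons, Finset.sum_cons, ih, zpow_add₀ (hs j)]
  have := hv (∏ i, (C (w i)⁻¹ * X i) ^ p i - ∏ i, (C (w i)⁻¹ * X i) ^ q i) (fun s hs => by
    simp only [map_sub, map_prod, map_pow, map_mul, eval_C, eval_X]
    rw [key p s hs, key q s hs, sub_eq_zero]
    exact Finset.prod_congr rfl fun j _ => by rw [hpq j])
  simp only [map_sub, map_prod, map_pow, map_mul, eval_C, eval_X, sub_eq_zero] at this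
  simpa only [div_eq_inv_mul] using this

theorem prod_div_pow_toNat_eq_of_mem_monomialCone {b : ι → Fin n → ℤ} {w : ι → ℂ}
    (hw : ∀ i, w i ≠ 0) {v : ι → ℂ} (hv : v ∈ monomialCone b w) {r : ι → ℤ}
    (hr : ∑ i, r i • b i = 0) :
    ∏ i, (v i / w i) ^ (r i).toNat = ∏ i, (v i / w i) ^ (-r i).toNat := by
  refine prod_div_pow_eq_of_mem_monomialCone hw hv fun j => ?_
  rw [← sub_eq_zero, ← Finset.sum_sub_distrib]
  have := congrFun hr j
  rw [Finset.sum_apply] at this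
  refine Eq.trans (Finset.sum_congr rfl fun i _ => ?_) this
  rw [← sub_mul, Int.toNat_sub_toNat_neg]
  rfl

/-- Divisibility of `ℂˣ`, which allows characters of a sublattice to be extended. -/
theorem exists_zpow_eq_complexUnits {m : ℤ} (hm : m ≠ 0) (u : ℂˣ) : ∃ t : ℂˣ, t ^ m = u := by
  refine ⟨Units.mk0 (Complex.exp (Complex.log u / m)) (Complex.exp_ne_zero _), Units.ext ?_⟩
  have hm' : (m : ℂ) ≠ 0 := Int.cast_ne_zero.2 hm
  rw [Units.val_zpow_eq_zpow_val, Units.val_mk0, ← Complex.exp_int_mul, mul_div_cancel₀ _ hm',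
    Complex.exp_log u.ne_zero]

/-- The points of the cone without zero coordinate are parametrized by the torus. -/
theorem exists_eq_weightedMonomials_of_ne_zero {b : ι → Fin n → ℤ} {w : ι → ℂ}
    (hw : ∀ i, w i ≠ 0) {v : ι → ℂ} (hv : v ∈ monomialCone b w) (hv0 : ∀ i, v i ≠ 0) :
    ∃ s : Fin n → ℂ, (∀ j, s j ≠ 0) ∧ v = weightedMonomials b w s := by
  classical
  -- The character `r ↦ ∏ (v_i / w_i) ^ r_i` is trivial on the relations between the `b_i`, so it
  -- descends to the lattice they generate. It extends to `ℤ^n` because `ℂˣ` is divisible, and the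
  -- values on the unit vectors are the torus coordinates.
  let c : ι → Additive ℂˣ := fun i => Additive.ofMul (Units.mk0 (v i / w i) (div_ne_zero (hv0 i) (hw i)))
  let χ : (ι → ℤ) →ₗ[ℤ] Additive ℂˣ := Fintype.linearCombination ℤ c
  let B : (ι → ℤ) →ₗ[ℤ] (Fin n → ℤ) := Fintype.linearCombination ℤ b
  have hker : LinearMap.ker B ≤ LinearMap.ker χ := by
    intro r hr
    rw [LinearMap.mem_ker, Fintype.linearCombination_apply] at hr ⊢
    have h1 := prod_div_pow_toNat_eq_of_mem_monomialCone hw hv hr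
    apply Additive.toMul.injective
    rw [toMul_sum, toMul_zero]
    refine Units.ext ?_
    have h2 : ∀ i, (((r i • c i).toMul : ℂˣ) : ℂ) =
        (v i / w i) ^ (r i).toNat / (v i / w i) ^ (-r i).toNat := by
      intro i
      rw [toMul_zsmul, Units.val_zpow_eq_zpow_val, ← zpow_natCast, ← zpow_natCast,
        ← zpow_sub₀ (div_ne_zero (hv0 i) (hw i)), Int.toNat_sub_toNat_neg]
      rfl
    rw [Units.coe_prod, Finset.prod_congr rfl fun i _ => h2 i, Finset.prod_div_distrib, h1,
      div_self (Finset.prod_ne_zero_iff.2 fun i _ =>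
        pow_ne_zero _ (div_ne_zero (hv0 i) (hw i))), Units.val_one]
  let χ' : ((ι → ℤ) ⧸ LinearMap.ker B) →ₗ[ℤ] Additive ℂˣ := (LinearMap.ker B).liftQ χ hker
  let B' : ((ι → ℤ) ⧸ LinearMap.ker B) →ₗ[ℤ] (Fin n → ℤ) := (LinearMap.ker B).liftQ B le_rfl
  have hB' : Function.Injective B' := LinearMap.ker_eq_bot.1 (Submodule.ker_liftQ_eq_bot _ _ _ le_rfl)
  let _ : DivisibleBy (Additive ℂˣ) ℤ := divisibleByOfSMulRightSurj _ _ fun {m} hm u => by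
    obtain ⟨t, ht⟩ := exists_zpow_eq_complexUnits hm u.toMul
    exact ⟨Additive.ofMul t, Additive.toMul.injective ht⟩
  obtain ⟨σ, hσ⟩ := (Module.Baer.of_divisible (Additive ℂˣ)).extension_property B' hB' χ'
  have hσb : ∀ i, σ (b i) = c i := by
    intro i
    have := DFunLike.congr_fun hσ (Submodule.Quotient.mk (Pi.single i 1))
    simpa [B', χ', B, χ] using this
  refine ⟨fun j => ((σ (Pi.single j 1)).toMul : ℂˣ), fun j => Units.ne_zero _, ?_⟩
  funext i
  have h1 : c i = ∑ j, b i j • σ (Pi.single j 1) := by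
    rw [← hσb, LinearMap.pi_apply_eq_sum_univ σ (b i)]
    refine Finset.sum_congr rfl fun j _ => ?_
    congr 2
    funext l
    simp [Pi.single_apply, eq_comm]
  have h2 : v i / w i = ∏ j, (((σ (Pi.single j 1)).toMul : ℂˣ) : ℂ) ^ b i j := by
    have := congrArg (fun u : Additive ℂˣ => ((u.toMul : ℂˣ) : ℂ)) h1
    simpa [c, toMul_sum, toMul_zsmul, Units.coe_prod, Units.val_zpow_eq_zpow_val] using this
  rw [weightedMonomials, ← h2, mul_div_cancel₀ _ (hw i)]

/-- A point of the cone with a zero coordinate is supported on exponents in a hyperplane. -/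
theorem exists_linear_form_of_eq_zero {b : ι → Fin n → ℤ} {w : ι → ℂ} (hw : ∀ i, w i ≠ 0)
    {v : ι → ℂ} (hv : v ∈ monomialCone b w) {i₀ : ι} (hi₀ : v i₀ = 0) :
    ∃ l : Fin n → ℂ, l ≠ 0 ∧ ∀ i, v i ≠ 0 → ∑ j, l j * b i j = 0 := by
  classical
  let bq : ι → Fin n → ℚ := fun i j => b i j
  -- Were `b i₀` in the rational span of the exponents of non-zero coordinates, there would be a
  -- binomial equation with `v i₀` on one side and only non-zero coordinates on the other.
  have hnot : bq i₀ ∉ Submodule.span ℚ (bq '' {i | v i ≠ 0}) := by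
    intro hmem
    obtain ⟨l, hl, hlb⟩ := (Finsupp.mem_span_image_iff_linearCombination ℚ).1 hmem
    rw [Finsupp.mem_supported] at hl
    have hl0 : ∀ i, v i = 0 → l i = 0 := fun i hi => by
      by_contra h0
      exact hl (Finsupp.mem_support_iff.2 h0) hi
    obtain ⟨⟨N, hN⟩, hint⟩ := IsLocalization.exist_integer_multiples_of_finite
      (nonZeroDivisors ℤ) (fun i => l i)
    choose k hk using hint
    have hN0 : N ≠ 0 := nonZeroDivisors.ne_zero hN
    have hk' : ∀ i, (k i : ℚ) = N * l i := fun i => by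
      have := hk i
      simpa using this
    -- The relation is multiplied once more by `N`, so that the exponent `N * N` at `i₀` is positive
    -- whatever the sign of `N`.
    let r : ι → ℤ := fun i => (if i = i₀ then N * N else 0) - N * k i
    have hk0 : ∀ i, v i = 0 → k i = 0 := fun i hi => by
      have := hk' i
      rw [hl0 i hi, mul_zero] at this
      exact_mod_cast this
    have hr : ∑ i, r i • b i = 0 := by
      funext j
      have h1 : ∑ i, l i * (b i j : ℚ) = b i₀ j := by
        have := congrFun hlb j
        rw [Finsupp.linearCombination_apply, Finsupp.sum_fintype _ _ (by simp),
          Finset.sum_apply] at this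
        simpa [bq] using this
      have h2 : ((∑ i, r i * b i j : ℤ) : ℚ) = 0 := by
        push_cast [r]
        simp_rw [sub_mul, Finset.sum_sub_distrib, hk', mul_assoc, ← Finset.mul_sum, h1]
        simp [ite_mul, mul_assoc]
      rw [Finset.sum_apply]
      exact_mod_cast h2
    have h1 := prod_div_pow_toNat_eq_of_mem_monomialCone hw hv hr
    have hri₀ : r i₀ = N * N := by simp [r, hk0 i₀ hi₀]
    have hpos : 0 < N * N := mul_self_pos.2 hN0
    rw [Finset.prod_eq_zero (Finset.mem_univ i₀)
      (by rw [hi₀, zero_div, zero_pow]; rw [hri₀]; lia)] at h1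
    refine Finset.prod_ne_zero_iff.2 (fun i _ => ?_) h1.symm
    by_cases hi : v i = 0
    · have : (-r i).toNat = 0 := by
        by_cases hii : i = i₀
        · rw [hii, hri₀]; lia
        · simp [r, hii, hk0 i hi]
      rw [this, pow_zero]
      exact one_ne_zero
    · exact pow_ne_zero _ (div_ne_zero hi (hw i))
  obtain ⟨f, hf, hker⟩ := Submodule.exists_le_ker_of_notMem hnot
  have hfsum : ∀ u : Fin n → ℚ, f u = ∑ j, f (Pi.single j 1) * u j := by
    intro u
    rw [LinearMap.pi_apply_eq_sum_univ f u]
    refine Finset.sum_congr rfl fun j _ => ?_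
    rw [smul_eq_mul, mul_comm]
    congr 2
    funext l
    simp [Pi.single_apply, eq_comm]
  refine ⟨fun j => (f (Pi.single j 1) : ℂ), fun h0 => hf ?_, fun i hi => ?_⟩
  · rw [hfsum]
    refine Finset.sum_eq_zero fun j _ => ?_
    have := congrFun h0 j
    simp only [Pi.zero_apply, Rat.cast_eq_zero] at this
    rw [this, zero_mul]
  · have h0 : f (bq i) = 0 := hker (Submodule.subset_span ⟨i, hi, rfl⟩)
    rw [hfsum] at h0
    have := congrArg (Rat.cast : ℚ → ℂ) h0
    simpa [bq] using this

end Binomial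

/-! ### The affine cone over the toric variety and its linear projection. -/

section HomogenizedExponents

open MvPolynomial

variable {d : ℕ} {ι : Type*}

/-- The exponents `(1, a_i)`. -/
def homogenizedExponents (a : ι → Fin d → ℤ) : ι → Fin (d + 1) → ℤ :=
  fun i => Fin.cons 1 (a i)

theorem weightedMonomials_homogenizedExponents {K : Type*} [Field K] (a : ι → Fin d → ℤ)
    (w : ι → K) (s : Fin (d + 1) → K) :
    weightedMonomials (homogenizedExponents a) w s =
      s 0 • weightedMonomials a w (Fin.tail s) := by
  funext i
  simp only [weightedMonomials, homogenizedExponents, Fin.prod_univ_succ, Fin.cons_zero,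
    Fin.cons_succ, zpow_one, Pi.smul_apply, smul_eq_mul, Fin.tail]
  ring

theorem weightedMonomials_ofReal (a : ι → Fin d → ℤ) (w : ι → ℝ) (x : Fin d → ℝ) (i : ι) :
    weightedMonomials a (fun i => (w i : ℂ)) (fun j => (x j : ℂ)) i =
      (weightedMonomials a w x i : ℝ) := by
  simp [weightedMonomials]

theorem ofReal_weights_ne_zero {a : ι → Fin d → ℤ} {w : ι → ℝ} (h : IsToricData a w) (i : ι) : (w i : ℂ) ≠ 0 :=
  Complex.ofReal_ne_zero.2 (h.pos i).ne'

variable [Fintype ι]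

theorem tautologicalLinear_apply (a : ι → Fin d → ℤ) (y : ι → ℂ) (j : Fin (d + 1)) :
    tautologicalLinear a y j = ∑ i, y i * (homogenizedExponents a i j : ℂ) := by
  simp only [tautologicalLinear, Finset.sum_apply, Pi.smul_apply, smul_eq_mul,
    homogenizedExponents]
  refine Finset.sum_congr rfl fun i _ => ?_
  refine Fin.cases ?_ (fun j => ?_) j <;> simp

theorem tautologicalLinear_zero (a : ι → Fin d → ℤ) (y : ι → ℂ) :
    tautologicalLinear a y 0 = ∑ i, y i := by
  simp [tautologicalLinear_apply, homogenizedExponents]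

theorem tautologicalLinear_succ (a : ι → Fin d → ℤ) (y : ι → ℂ) (j : Fin d) :
    tautologicalLinear a y j.succ = ∑ i, y i * (a i j : ℂ) := by
  simp [tautologicalLinear_apply, homogenizedExponents]

theorem tautologicalLinear_smul (a : ι → Fin d → ℤ) (t : ℂ) (y : ι → ℂ) :
    tautologicalLinear a (t • y) = t • tautologicalLinear a y := by
  funext j
  simp only [tautologicalLinear_apply, Pi.smul_apply, smul_eq_mul, Finset.mul_sum, mul_assoc]

/-- The linear forms defining the tautological projection. -/
noncomputable def tautologicalForm (a : ι → Fin d → ℤ) (j : Fin (d + 1)) : MvPolynomial ι ℂ :=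
  ∑ i, C (homogenizedExponents a i j : ℂ) * X i

theorem eval_tautologicalForm (a : ι → Fin d → ℤ) (j : Fin (d + 1)) (v : ι → ℂ) :
    eval v (tautologicalForm a j) = tautologicalLinear a v j := by
  simp only [tautologicalForm, map_sum, map_mul, eval_C, eval_X, tautologicalLinear_apply]
  exact Finset.sum_congr rfl fun i _ => mul_comm _ _

theorem eval_bind₁_tautologicalForm (a : ι → Fin d → ℤ) (F : MvPolynomial (Fin (d + 1)) ℂ)
    (v : ι → ℂ) : eval v (bind₁ (tautologicalForm a) F) = eval (tautologicalLinear a v) F := by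
  rw [← coe_aeval_eq_eval, RingHom.coe_coe, aeval_bind₁, ← coe_aeval_eq_eval, RingHom.coe_coe]
  congr 2
  funext j
  exact eval_tautologicalForm a j v

variable {a : ι → Fin d → ℤ} {w : ι → ℝ}

/-- The tautological projection of a real positive point, in terms of the moment map. -/
theorem tautologicalLinear_weightedMonomials_ofReal (h : IsToricData a w) {x : Fin d → ℝ}
    (hx : ∀ j, 0 < x j) (t : ℂ) :
    tautologicalLinear a ((t / (∑ k, weightedMonomials a w x k : ℝ)) •
        weightedMonomials a (fun i => (w i : ℂ)) (fun j => (x j : ℂ))) =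
      Fin.cons t fun j => t * (momentMap a (fun i => modelProbability a w i x) j : ℝ) := by
  have hZ := (sum_weightedMonomials_pos h hx).ne'
  have hZ' : ((∑ k, weightedMonomials a w x k : ℝ) : ℂ) ≠ 0 := Complex.ofReal_ne_zero.2 hZ
  rw [tautologicalLinear_smul]
  funext j
  refine Fin.cases ?_ (fun j => ?_) j
  · rw [Pi.smul_apply, tautologicalLinear_zero, Fin.cons_zero, smul_eq_mul]
    simp_rw [weightedMonomials_ofReal]
    rw [← Complex.ofReal_sum, div_mul_cancel₀ _ hZ']
  · rw [Pi.smul_apply, tautologicalLinear_succ, Fin.cons_succ, smul_eq_mul, momentMap_apply]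
    simp_rw [weightedMonomials_ofReal, modelProbability, div_mul_eq_mul_div]
    rw [← Finset.sum_div]
    push_cast
    ring

/-- Birch's theorem in homogeneous form: the additional parameter `s 0 = t / Z` scales the
coordinate sum to `t`. -/
theorem exists_tautologicalLinear_eq (h : IsToricData a w) {y : Fin d → ℝ}
    (hy : y ∈ interior (domainPolytope (realPoints a))) {t : ℝ} (ht : 0 < t) :
    ∃ s : Fin (d + 1) → ℝ, (∀ j, 0 < s j) ∧
      tautologicalLinear a (weightedMonomials (homogenizedExponents a) (fun i => (w i : ℂ))
        fun j => (s j : ℂ)) = Fin.cons (t : ℂ) fun j => (t * y j : ℂ) := by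
  obtain ⟨x, hx, hxy⟩ := exists_momentMap_eq_of_mem_interior h hy
  have hZ := sum_weightedMonomials_pos h hx
  refine ⟨Fin.cons (t / ∑ k, weightedMonomials a w x k) x, fun j => ?_, ?_⟩
  · refine Fin.cases ?_ (fun j => ?_) j
    · exact div_pos ht hZ
    · exact hx j
  · have := tautologicalLinear_weightedMonomials_ofReal h hx t
    rw [hxy] at this
    rw [← this, weightedMonomials_homogenizedExponents]
    simp [Fin.tail_def]

/-- Polynomials vanishing on the tautological projection of the real positive torus vanish. -/
theorem eq_zero_of_eval_tautologicalLinear_eq_zero (h : IsToricData a w)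
    {F : MvPolynomial (Fin (d + 1)) ℂ}
    (hF : ∀ s : Fin (d + 1) → ℝ, (∀ j, 0 < s j) →
      eval (tautologicalLinear a (weightedMonomials (homogenizedExponents a) (fun i => (w i : ℂ))
        fun j => (s j : ℂ))) F = 0) : F = 0 := by
  -- The open cone over the interior of `Δ` lies in the image of the positive torus. It contains a
  -- sup-norm ball, that is, a product of intervals, on which only the zero polynomial vanishes.
  let U : Set (Fin (d + 1) → ℝ) := {z | z 0 ∈ Set.Ioi 0} ∩
    (fun z => fun j : Fin d => z j.succ / z 0) ⁻¹' interior (domainPolytope (realPoints a))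
  have hU : IsOpen U := by
    refine ContinuousOn.isOpen_inter_preimage ?_ (isOpen_Ioi.preimage (continuous_apply 0))
      isOpen_interior
    refine continuousOn_pi.2 fun j => ?_
    exact (continuous_apply _).continuousOn.div (continuous_apply _).continuousOn
      fun z hz => (ne_of_gt hz)
  obtain ⟨y, hy⟩ := interior_domainPolytope_nonempty h
  have hyU : (Fin.cons 1 y : Fin (d + 1) → ℝ) ∈ U := by
    refine ⟨?_, ?_⟩
    · simp
    · simpa using hy
  obtain ⟨r, hr, hball⟩ := Metric.isOpen_iff.1 hU _ hyU
  refine MvPolynomial.funext_set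
    (fun j => Complex.ofReal '' Metric.ball ((Fin.cons 1 y : Fin (d + 1) → ℝ) j) r)
    (fun j => ?_) fun x hx => ?_
  · refine Set.Infinite.image Complex.ofReal_injective.injOn ?_
    rw [Real.ball_eq_Ioo]
    exact Set.Ioo_infinite (by linarith)
  · choose z hz hzx using fun j => hx j (Set.mem_univ j)
    obtain rfl : (fun j => (z j : ℂ)) = x := funext hzx
    have hzU : z ∈ U := hball ((dist_pi_lt_iff hr).2 hz)
    obtain ⟨s, hs, e⟩ := exists_tautologicalLinear_eq h hzU.2 hzU.1
    have h0 := hF s hs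
    have hz0 : (z 0 : ℂ) ≠ 0 := Complex.ofReal_ne_zero.2 (ne_of_gt hzU.1)
    rw [e] at h0
    rw [map_zero, ← h0]
    congr 1
    congr 1
    funext j
    refine Fin.cases ?_ (fun j => ?_) j
    · simp
    · simp [mul_div_cancel₀ _ hz0]

/-- The general fibres of the tautological projection on the affine cone have a constant number
of points, and this number is one exactly if the coordinates are rational functions of the
projection. -/
theorem exists_card_tautological_fibre (h : IsToricData a w) :
    ∃ N : ℕ, (N = 1 ↔ ∀ i, ∃ P Q : MvPolynomial (Fin (d + 1)) ℂ, Q ≠ 0 ∧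
        ∀ v ∈ monomialCone (homogenizedExponents a) (fun i => (w i : ℂ)),
          v i * eval (tautologicalLinear a v) Q = eval (tautologicalLinear a v) P) ∧
      ∃ G : MvPolynomial (Fin (d + 1)) ℂ, G ≠ 0 ∧ ∀ c, eval c G ≠ 0 →
        {v | v ∈ monomialCone (homogenizedExponents a) (fun i => (w i : ℂ)) ∧
          tautologicalLinear a v = c}.encard = N := by
  set y := monomialGenericPoint (homogenizedExponents a) (fun i => (w i : ℂ)) with hydef
  set z : Fin (d + 1) → FractionRing (MvPolynomial (Fin (d + 1)) ℂ) :=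
    fun j => aeval y (tautologicalForm a j) with hzdef
  have hzF : ∀ F, aeval z F = aeval y (bind₁ (tautologicalForm a) F) := fun F => by
    rw [aeval_bind₁]
  have hz : AlgebraicIndependent ℂ z := by
    rw [algebraicIndependent_iff]
    intro F hF
    rw [hzF] at hF
    refine eq_zero_of_eval_tautologicalLinear_eq_zero h fun s hs => ?_
    rw [← eval_bind₁_tautologicalForm]
    exact eval_eq_zero_of_aeval_monomialGenericPoint hF
      fun j => Complex.ofReal_ne_zero.2 (hs j).ne'
  -- These are `d + 1` independent elements in a field of transcendence degree `d + 1`.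
  have hbasis : IsTranscendenceBasis ℂ z :=
    hz.isTranscendenceBasis_of_trdeg_le_of_finite (by
      rw [trdeg_fractionRing_mvPolynomial, Cardinal.mk_fin])
  have halg := hbasis.isAlgebraic
  obtain ⟨N, hN, G, hG, hcard⟩ := exists_generic_fibre_card y z (tautologicalForm a) hz
    (fun j => rfl) (fun i => halg.isAlgebraic _)
  refine ⟨N, ?_, G, hG, fun c hc => ?_⟩
  · rw [hN]
    refine forall_congr' fun i => exists_congr fun P => exists_congr fun Q =>
      and_congr_right fun _ => ?_
    have h1 : y i * aeval z Q = aeval z P ↔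
        aeval y (X i * bind₁ (tautologicalForm a) Q - bind₁ (tautologicalForm a) P) = 0 := by
      rw [map_sub, map_mul, aeval_X, ← hzF, ← hzF, sub_eq_zero]
    have h2 : ∀ v, eval v (X i * bind₁ (tautologicalForm a) Q - bind₁ (tautologicalForm a) P) = 0 ↔
        v i * eval (tautologicalLinear a v) Q = eval (tautologicalLinear a v) P := by
      intro v
      rw [map_sub, map_mul, eval_X, eval_bind₁_tautologicalForm, eval_bind₁_tautologicalForm,
        sub_eq_zero]
    rw [h1, hydef, aeval_monomialGenericPoint_eq_zero]
    constructor
    · intro h0 v hv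
      exact (h2 v).1 (hv _ h0)
    · intro h0 s hs
      exact (h2 _).2 (h0 _ (weightedMonomials_mem_monomialCone hs))
  · rw [← hcard c hc]
    congr 1
    ext v
    simp only [Set.mem_ofPred_eq, monomialCone, hydef, aeval_monomialGenericPoint_eq_zero,
      eval_tautologicalForm, funext_iff]

end HomogenizedExponents

/-! ### The degree of the tautological projection and the maximum likelihood degree -/

section Homogeneous

open MvPolynomial

variable {σ : Type*}

theorem MvPolynomial.IsHomogeneous.eval_smul_eq {R : Type*} [CommSemiring R] {F : MvPolynomial σ R}
    {n : ℕ} (hF : F.IsHomogeneous n) (t : R) (u : σ → R) :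
    eval (t • u) F = t ^ n * eval u F := by
  rw [eval_eq, eval_eq, Finset.mul_sum]
  refine Finset.sum_congr rfl fun m hm => ?_
  have hdeg : ∑ i ∈ m.support, m i = n := by
    have := hF (mem_support_iff.1 hm)
    rw [Finsupp.weight_apply, Finsupp.sum] at this
    simpa using this
  simp only [Pi.smul_apply, smul_eq_mul, mul_pow, Finset.prod_mul_distrib,
    Finset.prod_pow_eq_pow_sum, hdeg]
  ring

/-- The values of the components at `u` are the coefficients of the one-variable polynomial `t ↦ F(t
u)`, which has infinitely many zeros. -/
theorem MvPolynomial.eval_homogeneousComponent_eq_zero {F : MvPolynomial σ ℂ} {u : σ → ℂ}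
    (h : ∀ t : ℂ, t ≠ 0 → eval (t • u) F = 0) (k : ℕ) :
    eval u (homogeneousComponent k F) = 0 := by
  let q : Polynomial ℂ := ∑ k ∈ Finset.range (F.totalDegree + 1),
    Polynomial.monomial k (eval u (homogeneousComponent k F))
  have hq : ∀ t, q.eval t = eval (t • u) F := by
    intro t
    conv_rhs => rw [← sum_homogeneousComponent F]
    simp only [q, Polynomial.eval_finsetSum, Polynomial.eval_monomial, map_sum]
    refine Finset.sum_congr rfl fun k _ => ?_
    rw [(homogeneousComponent_isHomogeneous k F).eval_smul_eq, mul_comm]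
  have hq0 : q = 0 := by
    refine Polynomial.eq_zero_of_infinite_isRoot q (Set.Infinite.mono (s := {0}ᶜ) ?_ ?_)
    · intro t ht
      exact (hq t).trans (h t ht)
    · exact (Set.finite_singleton _).infinite_compl
  by_cases hk : k < F.totalDegree + 1
  · have := congrArg (fun q => Polynomial.coeff q k) hq0
    simpa [q, Polynomial.finsetSum_coeff, Polynomial.coeff_monomial, hk] using this
  · rw [homogeneousComponent_eq_zero k F (by lia), map_zero]

theorem MvPolynomial.exists_homogeneousComponent_ne_zero {F : MvPolynomial σ ℂ} (hF : F ≠ 0) :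
    ∃ k, homogeneousComponent k F ≠ 0 := by
  by_contra! h
  refine hF ?_
  rw [← sum_homogeneousComponent F]
  exact Finset.sum_eq_zero fun k _ => h k

theorem MvPolynomial.exists_eval_ne_zero {F : MvPolynomial σ ℂ} (hF : F ≠ 0) :
    ∃ u, eval u F ≠ 0 := by
  by_contra! h
  exact hF (MvPolynomial.funext fun u => by rw [h u, map_zero])

end Homogeneous

/-- Counting points of projective space by chosen representatives. -/
theorem encard_projectivization_mk {V : Type*} [AddCommGroup V] [Module ℂ V] {S : Set V}
    (hS : ∀ v ∈ S, v ≠ 0) (hinj : ∀ v ∈ S, ∀ t : ℂ, t • v ∈ S → t = 1) :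
    {y : ℙ ℂ V | ∃ v ∈ S, ∃ hv : v ≠ 0, y = Projectivization.mk ℂ v hv}.encard = S.encard := by
  symm
  let f : S → {y : ℙ ℂ V | ∃ v ∈ S, ∃ hv : v ≠ 0, y = Projectivization.mk ℂ v hv} :=
    fun v => ⟨Projectivization.mk ℂ v.1 (hS v.1 v.2), v.1, v.2, hS v.1 v.2, rfl⟩
  refine Set.encard_congr (Equiv.ofBijective f ⟨fun v v' e => ?_, ?_⟩)
  · obtain ⟨t, ht⟩ := (Projectivization.mk_eq_mk_iff' ℂ _ _ _ _).1 (congrArg Subtype.val e)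
    have := hinj v'.1 v'.2 t (by rw [ht]; exact v.2)
    rw [this, one_smul] at ht
    exact Subtype.ext ht.symm
  · rintro ⟨_, v, hv, h0, rfl⟩
    exact ⟨⟨v, hv⟩, rfl⟩

section Degrees

open MvPolynomial

variable {d : ℕ} {ι : Type*} {a : ι → Fin d → ℤ} {w : ι → ℝ}

/-- The parameter `s 0` scales the parametrized torus, so the ideal of the cone is homogeneous. This
identifies the cone with the one over `toricVariety`. -/
theorem mem_monomialCone_iff_homogeneous {v : ι → ℂ} :
    v ∈ monomialCone (homogenizedExponents a) (fun i => (w i : ℂ)) ↔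
      ∀ (n : ℕ) (F : MvPolynomial ι ℂ), F.IsHomogeneous n →
        (∀ x : Fin d → ℂ, (∀ j, x j ≠ 0) →
          eval (weightedMonomials a (fun i => (w i : ℂ)) x) F = 0) → eval v F = 0 := by
  constructor
  · intro hv n F hF h
    refine hv F fun s hs => ?_
    rw [weightedMonomials_homogenizedExponents, hF.eval_smul_eq,
      h (Fin.tail s) fun j => hs j.succ, mul_zero]
  · intro hv F hF
    rw [← sum_homogeneousComponent F, map_sum]
    refine Finset.sum_eq_zero fun k _ => hv k _ (homogeneousComponent_isHomogeneous k F)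
      fun x hx => ?_
    refine eval_homogeneousComponent_eq_zero (fun t ht => ?_) k
    have := hF (Fin.cons t x) (fun j => Fin.cases ht hx j)
    rwa [weightedMonomials_homogenizedExponents, Fin.cons_zero, Fin.tail_cons] at this

theorem smul_mem_monomialCone {v : ι → ℂ}
    (hv : v ∈ monomialCone (homogenizedExponents a) (fun i => (w i : ℂ))) (t : ℂ) :
    t • v ∈ monomialCone (homogenizedExponents a) (fun i => (w i : ℂ)) := by
  rw [mem_monomialCone_iff_homogeneous] at hv ⊢
  intro n F hF h
  rw [hF.eval_smul_eq, hv n F hF h, mul_zero]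

theorem smul_weightedMonomials_mem_monomialCone {t : ℂ} (ht : t ≠ 0) {x : Fin d → ℂ}
    (hx : ∀ j, x j ≠ 0) : t • weightedMonomials a (fun i => (w i : ℂ)) x ∈
      monomialCone (homogenizedExponents a) (fun i => (w i : ℂ)) := by
  have := weightedMonomials_mem_monomialCone (b := homogenizedExponents a)
    (w := fun i => (w i : ℂ)) (s := Fin.cons t x) (fun j => Fin.cases ht hx j)
  rwa [weightedMonomials_homogenizedExponents, Fin.cons_zero, Fin.tail_cons] at this

theorem mem_toricVariety_iff {y : ℙ ℂ (ι → ℂ)} :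
    y ∈ toricVariety a w ↔
      y.rep ∈ monomialCone (homogenizedExponents a) (fun i => (w i : ℂ)) :=
  mem_monomialCone_iff_homogeneous.symm

theorem hasFDerivAt_weightedMonomials (a : ι → Fin d → ℤ) (w : ι → ℂ) (i : ι) {x : Fin d → ℂ}
    (hx : ∀ j, x j ≠ 0) :
    HasFDerivAt (fun x => weightedMonomials a w x i)
      (weightedMonomials a w x i • ∑ j, ((a i j : ℂ) / x j) •
        ContinuousLinearMap.proj (R := ℂ) (φ := fun _ : Fin d => ℂ) j) x := by
  classical
  have h1 : ∀ j ∈ Finset.univ, HasFDerivAt (fun x : Fin d → ℂ => x j ^ a i j)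
      (((a i j : ℂ) * x j ^ (a i j - 1)) •
        ContinuousLinearMap.proj (R := ℂ) (φ := fun _ : Fin d => ℂ) j) x := fun j _ =>
    HasDerivAt.comp_hasFDerivAt (h₂ := fun y => y ^ a i j) x
      (hasDerivAt_zpow (a i j) (x j) (Or.inl (hx j)))
      (hasFDerivAt_apply (𝕜 := ℂ) (F' := fun _ : Fin d => ℂ) j x)
  refine ((HasFDerivAt.finsetProd h1).const_mul (w i)).congr_fderiv ?_
  rw [weightedMonomials, mul_smul]
  congr 1
  rw [Finset.smul_sum]
  refine Finset.sum_congr rfl fun j _ => ?_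
  rw [smul_smul, smul_smul, ← Finset.prod_erase_mul _ _ (Finset.mem_univ j), zpow_sub_one₀ (hx j)]
  congr 1
  ring

variable [Fintype ι]

/-- The points of the affine cone over a point of the target of the tautological projection. -/
def coneFibre (a : ι → Fin d → ℤ) (w : ι → ℝ) (c : Fin (d + 1) → ℂ) : Set (ι → ℂ) :=
  {v | v ∈ monomialCone (homogenizedExponents a) (fun i => (w i : ℂ)) ∧
    tautologicalLinear a v = c}

/-- A prescribed non-zero value of the linear projection fixes the scale of a representative. -/
theorem encard_mk_coneFibre {c : Fin (d + 1) → ℂ} (hc : c ≠ 0) :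
    {y : ℙ ℂ (ι → ℂ) | ∃ v ∈ coneFibre a w c, ∃ hv : v ≠ 0,
      y = Projectivization.mk ℂ v hv}.encard = (coneFibre a w c).encard := by
  refine encard_projectivization_mk ?_ ?_
  · rintro v ⟨-, hv⟩ rfl
    refine hc ?_
    rw [← hv]
    funext j
    simp [tautologicalLinear_apply]
  · rintro v ⟨-, hv⟩ t ⟨-, ht⟩
    rw [tautologicalLinear_smul, hv] at ht
    obtain ⟨j, hj⟩ := Function.ne_iff.1 hc
    have := congrFun ht j
    rw [Pi.smul_apply, smul_eq_mul] at this
    exact mul_right_cancel₀ hj (this.trans (one_mul _).symm)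

/-- Cone and projection are both compatible with scaling. The free factor `t` serves to avoid the
zeros of an inhomogeneous polynomial on the line of `z`. -/
theorem encard_tautologicalFibre (z : ℙ ℂ (Fin (d + 1) → ℂ)) {t : ℂ} (ht : t ≠ 0) :
    (tautologicalFibre a w z).encard = (coneFibre a w (t • z.rep)).encard := by
  rw [← encard_mk_coneFibre (smul_ne_zero ht z.rep_nonzero)]
  congr 1
  ext y
  constructor
  · rintro ⟨hy, h0, hz⟩
    rw [mem_toricVariety_iff] at hy
    rw [← z.mk_rep, Projectivization.mk_eq_mk_iff'] at hz
    obtain ⟨r, hr⟩ := hz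
    have hr0 : r ≠ 0 := by
      rintro rfl
      rw [zero_smul] at hr
      exact h0 hr.symm
    have htr : t / r ≠ 0 := div_ne_zero ht hr0
    refine ⟨(t / r) • y.rep, ⟨smul_mem_monomialCone hy _, ?_⟩,
      smul_ne_zero htr y.rep_nonzero, ?_⟩
    · rw [tautologicalLinear_smul, ← hr, smul_smul, div_mul_cancel₀ _ hr0]
    · conv_lhs => rw [← y.mk_rep]
      rw [Projectivization.mk_eq_mk_iff']
      exact ⟨(t / r)⁻¹, by rw [smul_smul, inv_mul_cancel₀ htr, one_smul]⟩
  · rintro ⟨v, ⟨hv, hvz⟩, hv0, rfl⟩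
    have hrep := (Projectivization.mk ℂ v hv0).mk_rep
    rw [Projectivization.mk_eq_mk_iff'] at hrep
    obtain ⟨r, hr⟩ := hrep
    have hr0 : r ≠ 0 := by
      rintro rfl
      rw [zero_smul] at hr
      exact (Projectivization.mk ℂ v hv0).rep_nonzero hr.symm
    have hlin : tautologicalLinear a (Projectivization.mk ℂ v hv0).rep = (r * t) • z.rep := by
      rw [← hr, tautologicalLinear_smul, hvz, smul_smul]
    refine ⟨?_, ?_, ?_⟩
    · rw [mem_toricVariety_iff, ← hr]
      exact smul_mem_monomialCone hv r
    · rw [hlin]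
      exact smul_ne_zero (mul_ne_zero hr0 ht) z.rep_nonzero
    · conv_rhs => rw [← z.mk_rep]
      rw [Projectivization.mk_eq_mk_iff']
      exact ⟨r * t, hlin.symm⟩

/-- The zero coordinates of points of the cone only occur over finitely many hyperplanes. -/
theorem exists_ne_zero_of_mem_monomialCone (h : IsToricData a w) :
    ∃ G : MvPolynomial (Fin (d + 1)) ℂ, G ≠ 0 ∧
      ∀ v ∈ monomialCone (homogenizedExponents a) (fun i => (w i : ℂ)),
        eval (tautologicalLinear a v) G ≠ 0 → ∀ i, v i ≠ 0 := by
  classical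
  -- For each possible support `S` take a linear form vanishing on the exponents in `S` if there is
  -- a non-zero one, and an arbitrary one otherwise. The product of all these forms is the required
  -- polynomial: a point with a zero coordinate has a support of the first kind.
  have hex : ∀ S : Finset ι, ∃ l : Fin (d + 1) → ℂ, l ≠ 0 ∧
      ((∃ l' : Fin (d + 1) → ℂ, l' ≠ 0 ∧
        ∀ i ∈ S, ∑ j, l' j * (homogenizedExponents a i j : ℂ) = 0) →
        ∀ i ∈ S, ∑ j, l j * (homogenizedExponents a i j : ℂ) = 0) := by
    intro S
    by_cases hS : ∃ l' : Fin (d + 1) → ℂ, l' ≠ 0 ∧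
        ∀ i ∈ S, ∑ j, l' j * (homogenizedExponents a i j : ℂ) = 0
    · obtain ⟨l, hl, hl'⟩ := hS
      exact ⟨l, hl, fun _ => hl'⟩
    · exact ⟨1, one_ne_zero, fun h => absurd h hS⟩
  choose l hl hlS using hex
  refine ⟨∏ S : Finset ι, ∑ j, C (l S j) * X j, ?_, fun v hv hG i₀ hi₀ => hG ?_⟩
  · refine Finset.prod_ne_zero_iff.2 fun S _ h0 => hl S ?_
    funext j
    have := congrArg (eval (Pi.single j 1)) h0
    simpa [Pi.single_apply] using this
  · rw [map_prod]
    refine Finset.prod_eq_zero (Finset.mem_univ (Finset.univ.filter fun i => v i ≠ 0)) ?_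
    obtain ⟨l', hl', h0⟩ := exists_linear_form_of_eq_zero (ofReal_weights_ne_zero h) hv hi₀
    have hzero := hlS (Finset.univ.filter fun i => v i ≠ 0)
      ⟨l', hl', fun i hi => h0 i (Finset.mem_filter.1 hi).2⟩
    simp only [map_sum, map_mul, eval_C, eval_X, tautologicalLinear_apply, Finset.mul_sum]
    rw [Finset.sum_comm]
    refine Finset.sum_eq_zero fun i _ => ?_
    by_cases hi : v i = 0
    · simp [hi]
    · have := hzero i (Finset.mem_filter.2 ⟨Finset.mem_univ i, hi⟩)
      rw [Finset.sum_congr rfl fun j _ => mul_left_comm _ (v i) _, ← Finset.mul_sum, this,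
        mul_zero]

/-! #### The critical equations -/

theorem hasFDerivAt_modelProbability (a : ι → Fin d → ℤ) (w : ι → ℂ) (i : ι) {x : Fin d → ℂ}
    (hx : ∀ j, x j ≠ 0) (hZ : ∑ k, weightedMonomials a w x k ≠ 0) :
    HasFDerivAt (modelProbability a w i)
      (modelProbability a w i x • ∑ j, (((a i j : ℂ) -
        (∑ k, weightedMonomials a w x k * a k j) / ∑ k, weightedMonomials a w x k) / x j) •
          ContinuousLinearMap.proj (R := ℂ) (φ := fun _ : Fin d => ℂ) j) x := by
  have h1 := hasFDerivAt_weightedMonomials a w i hx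
  have h2 : HasFDerivAt (fun x => ∑ k, weightedMonomials a w x k) _ x :=
    HasFDerivAt.fun_sum fun k (_ : k ∈ Finset.univ) => hasFDerivAt_weightedMonomials a w k hx
  have h3 := (hasDerivAt_inv hZ).comp_hasFDerivAt x h2
  have h4 := h1.mul h3
  refine HasFDerivAt.congr_fderiv (f := modelProbability a w i) h4 ?_
  refine ContinuousLinearMap.ext fun v => ?_
  simp only [modelProbability, _root_.add_apply, _root_.smul_apply, _root_.sum_apply,
    ContinuousLinearMap.proj_apply, smul_eq_mul, Function.comp_apply]
  have h5 : ∑ k, weightedMonomials a w x k * ∑ j, (a k j : ℂ) / x j * v j =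
      ∑ j, (∑ k, weightedMonomials a w x k * a k j) / x j * v j := by
    simp_rw [Finset.mul_sum, Finset.sum_div, Finset.sum_mul]
    rw [Finset.sum_comm]
    refine Finset.sum_congr rfl fun j _ => Finset.sum_congr rfl fun k _ => ?_
    ring
  have h6 : ∑ j, ((a i j : ℂ) - (∑ k, weightedMonomials a w x k * a k j) /
      ∑ k, weightedMonomials a w x k) / x j * v j = ∑ j, (a i j : ℂ) / x j * v j -
        (∑ k, weightedMonomials a w x k)⁻¹ *
          ∑ j, (∑ k, weightedMonomials a w x k * a k j) / x j * v j := by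
    rw [Finset.mul_sum, ← Finset.sum_sub_distrib]
    refine Finset.sum_congr rfl fun j _ => ?_
    ring
  rw [h5, h6]
  ring

/-- The coefficient of `dx_j / x_j` in `d log p_i` is `a_ij` minus the model mean of the `j`-th
exponents. Criticality therefore matches the moments of the data with those of the model. -/
theorem critical_equation_iff (a : ι → Fin d → ℤ) {w : ι → ℂ} (hw : ∀ i, w i ≠ 0) (u : ι → ℂ)
    {x : Fin d → ℂ} (hx : ∀ j, x j ≠ 0) (hZ : ∑ k, weightedMonomials a w x k ≠ 0) :
    ∑ i, (u i / modelProbability a w i x) • fderiv ℂ (modelProbability a w i) x = 0 ↔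
      ∀ j, ∑ i, u i * a i j =
        (∑ i, u i) / (∑ k, weightedMonomials a w x k) * ∑ k, weightedMonomials a w x k * a k j := by
  have hp : ∀ i, modelProbability a w i x ≠ 0 := fun i =>
    div_ne_zero (weightedMonomials_ne_zero hw hx i) hZ
  have h1 : ∑ i, (u i / modelProbability a w i x) • fderiv ℂ (modelProbability a w i) x =
      ∑ j, ((∑ i, u i * a i j - (∑ i, u i) / (∑ k, weightedMonomials a w x k) *
        ∑ k, weightedMonomials a w x k * a k j) / x j) •
          ContinuousLinearMap.proj (R := ℂ) (φ := fun _ : Fin d => ℂ) j := by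
    simp_rw [fun i => (hasFDerivAt_modelProbability a w i hx hZ).fderiv, smul_smul,
      fun i => div_mul_cancel₀ (u i) (hp i), Finset.smul_sum, smul_smul]
    rw [Finset.sum_comm]
    refine Finset.sum_congr rfl fun j _ => ?_
    rw [← Finset.sum_smul]
    congr 1
    simp_rw [mul_div_assoc', mul_sub, sub_div, Finset.sum_sub_distrib, ← Finset.sum_div,
      ← Finset.sum_mul]
    ring
  rw [h1]
  constructor
  · intro h0 j
    have := DFunLike.congr_fun h0 (Pi.single j 1)
    simp only [_root_.sum_apply, _root_.smul_apply,
      ContinuousLinearMap.proj_apply, smul_eq_mul, Pi.single_apply, mul_ite, mul_one, mul_zero,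
      Finset.sum_ite_eq', Finset.mem_univ, if_true, _root_.zero_apply] at this
    exact sub_eq_zero.1 ((div_eq_zero_iff.1 this).resolve_right (hx j))
  · intro h0
    refine Finset.sum_eq_zero fun j _ => ?_
    rw [h0 j, sub_self, zero_div]
    exact zero_smul ℂ (ContinuousLinearMap.proj (R := ℂ) (φ := fun _ : Fin d => ℂ) j)

/-- Scaling a critical point by `∑ u / ∑ w x^a` puts it into the cone fibre over the projection of
`u`. In the other direction, fibre points without zero coordinate are parametrized by the torus. -/
theorem encard_likelihoodCriticalPoints (h : IsToricData a w) {u : ι → ℂ} (hu : ∑ i, u i ≠ 0)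
    (hne : ∀ v ∈ coneFibre a w (tautologicalLinear a u), ∀ i, v i ≠ 0) :
    (likelihoodCriticalPoints a w u).encard =
      (coneFibre a w (tautologicalLinear a u)).encard := by
  have hu0 : tautologicalLinear a u ≠ 0 := fun h0 => hu (by
    rw [← tautologicalLinear_zero a, h0, Pi.zero_apply])
  rw [← encard_mk_coneFibre hu0]
  congr 1
  ext y
  constructor
  · rintro ⟨x, hx, ⟨h0, rfl⟩, hZ, hcrit⟩
    rw [critical_equation_iff a (ofReal_weights_ne_zero h) u hx hZ] at hcrit
    have ht : (∑ i, u i) / (∑ k, weightedMonomials a (fun i => (w i : ℂ)) x k) ≠ 0 :=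
      div_ne_zero hu hZ
    refine ⟨((∑ i, u i) / (∑ k, weightedMonomials a (fun i => (w i : ℂ)) x k)) •
      weightedMonomials a (fun i => (w i : ℂ)) x,
      ⟨smul_weightedMonomials_mem_monomialCone ht hx, ?_⟩, smul_ne_zero ht h0, ?_⟩
    · rw [tautologicalLinear_smul]
      funext j
      refine Fin.cases ?_ (fun j => ?_) j
      · rw [Pi.smul_apply, tautologicalLinear_zero, tautologicalLinear_zero, smul_eq_mul,
          div_mul_cancel₀ _ hZ]
      · rw [Pi.smul_apply, tautologicalLinear_succ, tautologicalLinear_succ, smul_eq_mul, hcrit j]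
    · rw [Projectivization.mk_eq_mk_iff']
      exact ⟨_, by rw [smul_smul, inv_mul_cancel₀ ht, one_smul]⟩
  · rintro ⟨v, hv, hv0, rfl⟩
    obtain ⟨s, hs, rfl⟩ := exists_eq_weightedMonomials_of_ne_zero (ofReal_weights_ne_zero h) hv.1
      (hne v hv)
    have hlin := hv.2
    simp only [weightedMonomials_homogenizedExponents, tautologicalLinear_smul] at hlin
    have hsum := congrFun hlin 0
    rw [Pi.smul_apply, tautologicalLinear_zero, tautologicalLinear_zero, smul_eq_mul] at hsum
    have hZ : ∑ k, weightedMonomials a (fun i => (w i : ℂ)) (Fin.tail s) k ≠ 0 := by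
      intro h0
      rw [h0, mul_zero] at hsum
      exact hu hsum.symm
    have hx : ∀ j, Fin.tail s j ≠ 0 := fun j => hs j.succ
    have h0 : weightedMonomials a (fun i => (w i : ℂ)) (Fin.tail s) ≠ 0 := fun h0 => hZ (by
      simp [h0])
    refine ⟨Fin.tail s, hx, ⟨h0, ?_⟩, hZ, ?_⟩
    · rw [Projectivization.mk_eq_mk_iff']
      exact ⟨s 0, (weightedMonomials_homogenizedExponents _ _ _).symm⟩
    · rw [critical_equation_iff a (ofReal_weights_ne_zero h) u hx hZ]
      intro j
      have hj := congrFun hlin j.succ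
      rw [Pi.smul_apply, tautologicalLinear_succ, tautologicalLinear_succ, smul_eq_mul] at hj
      rw [← hj, ← hsum, mul_div_cancel_right₀ _ hZ]

/-- Both degrees are the number of points in a general fibre of the tautological projection on the
affine cone. -/
theorem isMLDegree_and_isTautologicalDegree (h : IsToricData a w) {N : ℕ}
    {G : MvPolynomial (Fin (d + 1)) ℂ} (hG : G ≠ 0)
    (hcard : ∀ c, eval c G ≠ 0 → (coneFibre a w c).encard = N) :
    IsMLDegree a w N ∧ IsTautologicalDegree a w N := by
  constructor
  · obtain ⟨G', hG', hne⟩ := exists_ne_zero_of_mem_monomialCone h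
    -- The factors ensure the generic fibre cardinality, non-zero coordinates on the fibre, and `∑ u
    -- ≠ 0`, respectively.
    refine ⟨bind₁ (tautologicalForm a) (G * G' * X 0), fun h0 => ?_, fun u hu => ?_⟩
    · refine mul_ne_zero (mul_ne_zero hG hG') (X_ne_zero 0)
        (eq_zero_of_eval_tautologicalLinear_eq_zero h fun s _ => ?_)
      rw [← eval_bind₁_tautologicalForm, h0, map_zero]
    · rw [eval_bind₁_tautologicalForm, map_mul, map_mul, eval_X, tautologicalLinear_zero] at hu
      rw [encard_likelihoodCriticalPoints h (right_ne_zero_of_mul hu)]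
      · exact hcard _ (left_ne_zero_of_mul (left_ne_zero_of_mul hu))
      · intro v hv
        refine hne v hv.1 ?_
        rw [hv.2]
        exact right_ne_zero_of_mul (left_ne_zero_of_mul hu)
  -- `G` need not be homogeneous. Where one of its components is non-zero at `z.rep`, some non-zero
  -- multiple of `z.rep` is not a zero of `G`.
  · obtain ⟨k, hk⟩ := exists_homogeneousComponent_ne_zero hG
    refine ⟨k, homogeneousComponent k G, homogeneousComponent_isHomogeneous k G, hk,
      fun z hz => ?_⟩
    obtain ⟨t, ht, hGt⟩ : ∃ t : ℂ, t ≠ 0 ∧ eval (t • z.rep) G ≠ 0 := by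
      by_contra! h0
      exact hz (eval_homogeneousComponent_eq_zero h0 k)
    rw [encard_tautologicalFibre z ht, hcard _ hGt]

theorem IsMLDegree.unique {M N : ℕ} (hM : IsMLDegree a w M) (hN : IsMLDegree a w N) : M = N := by
  obtain ⟨g, hg, hgM⟩ := hM
  obtain ⟨g', hg', hgN⟩ := hN
  obtain ⟨u, hu⟩ := exists_eval_ne_zero (mul_ne_zero hg hg')
  rw [map_mul] at hu
  exact_mod_cast (hgM u (left_ne_zero_of_mul hu)).symm.trans (hgN u (right_ne_zero_of_mul hu))

theorem IsTautologicalDegree.unique {M N : ℕ} (hM : IsTautologicalDegree a w M)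
    (hN : IsTautologicalDegree a w N) : M = N := by
  obtain ⟨m, G, hGh, hG, hGM⟩ := hM
  obtain ⟨n, G', hGh', hG', hGN⟩ := hN
  -- The factor `X 0` only guarantees `c ≠ 0`, so that `c` represents a point of projective space.
  obtain ⟨c, hc⟩ := exists_eval_ne_zero (mul_ne_zero (mul_ne_zero hG hG') (X_ne_zero 0))
  rw [map_mul, map_mul, eval_X] at hc
  have hc0 : c ≠ 0 := fun h0 => hc (by rw [h0, Pi.zero_apply, mul_zero])
  have hrep := (Projectivization.mk ℂ c hc0).mk_rep
  rw [Projectivization.mk_eq_mk_iff'] at hrep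
  obtain ⟨r, hr⟩ := hrep
  have hr0 : r ≠ 0 := by
    rintro rfl
    rw [zero_smul] at hr
    exact (Projectivization.mk ℂ c hc0).rep_nonzero hr.symm
  have h1 := hGM (Projectivization.mk ℂ c hc0) (by
    rw [← hr, hGh.eval_smul_eq]
    exact mul_ne_zero (pow_ne_zero _ hr0) (left_ne_zero_of_mul (left_ne_zero_of_mul hc)))
  have h2 := hGN (Projectivization.mk ℂ c hc0) (by
    rw [← hr, hGh'.eval_smul_eq]
    exact mul_ne_zero (pow_ne_zero _ hr0) (right_ne_zero_of_mul (left_ne_zero_of_mul hc)))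
  exact_mod_cast h1.symm.trans h2

end Degrees

/-! ### Rational linear precision and maximum likelihood degree one -/

section Rational

open MvPolynomial

variable {d : ℕ} {ι : Type*} {a : ι → Fin d → ℤ} {w : ι → ℝ}

/-- A continuous function on the polytope is rational if it is so on the interior. -/
theorem isRationalFunction_of_interior (h : IsToricData a w)
    {f : domainPolytope (realPoints a) → ℝ} (hf : Continuous f) {P Q : MvPolynomial (Fin d) ℝ}
    (hQ : Q ≠ 0)
    (hPQ : ∀ y : domainPolytope (realPoints a),
      (y : Fin d → ℝ) ∈ interior (domainPolytope (realPoints a)) →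
        f y * eval (y : Fin d → ℝ) Q = eval (y : Fin d → ℝ) P) :
    ParametricPatch.IsRationalFunction f := by
  refine ⟨P, Q, hQ, fun x hx => ?_⟩
  rw [eq_div_iff hx]
  let D : Set (domainPolytope (realPoints a)) :=
    {y | (y : Fin d → ℝ) ∈ interior (domainPolytope (realPoints a))}
  have hD : Dense D := by
    rw [Subtype.dense_iff]
    refine (domainPolytope_subset_closure_interior h).trans (closure_mono fun y hy => ?_)
    exact ⟨⟨y, interior_subset hy⟩, hy, rfl⟩
  have hc : ∀ F : MvPolynomial (Fin d) ℝ,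
      Continuous fun y : domainPolytope (realPoints a) => eval (y : Fin d → ℝ) F := fun F =>
    (MvPolynomial.continuous_eval F).comp continuous_subtype_val
  exact congrFun (Continuous.ext_on hD (hf.mul (hc Q)) (hc P) fun y hy => hPQ y hy) x

/-- Used to descend from complex relations on the cone to real rational functions on the polytope.
-/
theorem exists_real_imaginary_parts {σ : Type*} (F : MvPolynomial σ ℂ) :
    ∃ A B : MvPolynomial σ ℝ, ∀ y : σ → ℝ,
      eval (fun j => (y j : ℂ)) F = (eval y A : ℝ) + (eval y B : ℝ) * Complex.I := by
  induction F using MvPolynomial.induction_on with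
  | C r => exact ⟨C r.re, C r.im, fun y => by simp [Complex.re_add_im]⟩
  | add F F' h h' =>
    obtain ⟨A, B, e⟩ := h
    obtain ⟨A', B', e'⟩ := h'
    refine ⟨A + A', B + B', fun y => ?_⟩
    rw [map_add, e, e']
    push_cast [map_add]
    ring
  | mul_X F j h =>
    obtain ⟨A, B, e⟩ := h
    refine ⟨A * X j, B * X j, fun y => ?_⟩
    rw [map_mul, e]
    push_cast [map_mul, eval_X]
    ring

/-- Homogenization, evaluated at `(t, t y)`. -/
theorem exists_homogenization (F : MvPolynomial (Fin d) ℝ) :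
    ∃ (D : ℕ) (H : MvPolynomial (Fin (d + 1)) ℂ), ∀ (t : ℂ) (y : Fin d → ℝ),
      eval (Fin.cons t fun j => t * (y j : ℂ) : Fin (d + 1) → ℂ) H = t ^ D * (eval y F : ℝ) := by
  induction F using MvPolynomial.induction_on with
  | C r => exact ⟨0, C (r : ℂ), fun t y => by simp⟩
  | add F F' h h' =>
    obtain ⟨D, H, e⟩ := h
    obtain ⟨D', H', e'⟩ := h'
    refine ⟨D + D', X 0 ^ D' * H + X 0 ^ D * H', fun t y => ?_⟩
    simp only [map_add, map_mul, map_pow, eval_X, e, e', Fin.cons_zero]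
    push_cast
    ring
  | mul_X F j h =>
    obtain ⟨D, H, e⟩ := h
    refine ⟨D + 1, H * X j.succ, fun t y => ?_⟩
    simp only [map_mul, eval_X, e, Fin.cons_succ]
    push_cast
    ring

variable [Fintype ι]

theorem isRationalFunction_inverse_of_cone (h : IsToricData a w)
    {ν : domainPolytope (realPoints a) → ι → ℝ} (hνc : Continuous ν)
    (hν : ∀ q ∈ closure (toricModel a w), ∀ y : domainPolytope (realPoints a),
      momentMap a q = y → ν y = q) {i : ι} {P Q : MvPolynomial (Fin (d + 1)) ℂ} (hQ : Q ≠ 0)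
    (hPQ : ∀ v ∈ monomialCone (homogenizedExponents a) (fun i => (w i : ℂ)),
      v i * eval (tautologicalLinear a v) Q = eval (tautologicalLinear a v) P) :
    ParametricPatch.IsRationalFunction (p := realPoints a) fun y => ν y i := by
  -- Since `Q` may be inhomogeneous, it could vanish on the chart `z₀ = 1`; the value `c 0` is
  -- chosen such that it does not vanish identically on `z₀ = c 0`.
  obtain ⟨c, hc⟩ := exists_eval_ne_zero (mul_ne_zero hQ (X_ne_zero 0))
  rw [map_mul, eval_X] at hc
  have hc0 : c 0 ≠ 0 := right_ne_zero_of_mul hc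
  -- restriction to the affine chart `z₀ = c₀`
  let τ : Fin (d + 1) → MvPolynomial (Fin d) ℂ := Fin.cons (C (c 0)) fun j => C (c 0) * X j
  have hτ : ∀ (F : MvPolynomial (Fin (d + 1)) ℂ) (u : Fin d → ℂ),
      eval u (bind₁ τ F) = eval (Fin.cons (c 0) fun j => c 0 * u j : Fin (d + 1) → ℂ) F := by
    intro F u
    rw [← coe_aeval_eq_eval, RingHom.coe_coe, aeval_bind₁, ← coe_aeval_eq_eval, RingHom.coe_coe]
    congr 2
    funext j
    refine Fin.cases ?_ (fun j => ?_) j <;> simp [τ]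
  obtain ⟨A, B, hAB⟩ := exists_real_imaginary_parts (bind₁ τ Q)
  -- The cone point with coordinate sum `c 0` is `c 0 • ν y`, whence the factor `(c 0)⁻¹`.
  obtain ⟨A', B', hAB'⟩ := exists_real_imaginary_parts (C (c 0)⁻¹ * bind₁ τ P)
  have hkey : ∀ y : domainPolytope (realPoints a),
      (y : Fin d → ℝ) ∈ interior (domainPolytope (realPoints a)) →
        ν y i * eval (y : Fin d → ℝ) A = eval (y : Fin d → ℝ) A' ∧
        ν y i * eval (y : Fin d → ℝ) B = eval (y : Fin d → ℝ) B' := by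
    intro y hy
    obtain ⟨x, hx, hxy⟩ := exists_momentMap_eq_of_mem_interior h hy
    have hνy := hν _ (subset_closure ⟨x, hx, rfl⟩) y hxy
    have hZ := (sum_weightedMonomials_pos h hx).ne'
    have hlin := tautologicalLinear_weightedMonomials_ofReal h hx (c 0)
    have hmem := smul_weightedMonomials_mem_monomialCone (a := a) (w := w)
      (div_ne_zero hc0 (Complex.ofReal_ne_zero.2 hZ))
      (x := fun j => (x j : ℂ)) fun j => Complex.ofReal_ne_zero.2 (hx j).ne'
    have h1 := hPQ _ hmem
    rw [hlin, hxy, ← hτ, ← hτ, Pi.smul_apply, smul_eq_mul, weightedMonomials_ofReal] at h1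
    have h2 : ((ν y i : ℝ) : ℂ) * eval (fun j => ((y : Fin d → ℝ) j : ℂ)) (bind₁ τ Q) =
        eval (fun j => ((y : Fin d → ℝ) j : ℂ)) (C (c 0)⁻¹ * bind₁ τ P) := by
      rw [map_mul, ← h1, eval_C, hνy]
      simp only [modelProbability]
      push_cast
      field_simp
    rw [hAB, hAB'] at h2
    constructor
    · simpa using congrArg Complex.re h2
    · simpa using congrArg Complex.im h2
  -- If both parts were zero, `Q` would vanish at the real points of the chart, hence on the whole
  -- chart and at `c`.
  have hne : A ≠ 0 ∨ B ≠ 0 := by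
    by_contra! h0
    have hzero : bind₁ τ Q = 0 := by
      refine MvPolynomial.funext_set (fun _ => Set.range Complex.ofReal)
        (fun _ => Set.infinite_range_of_injective Complex.ofReal_injective) fun x hx => ?_
      choose y hy using fun j => hx j (Set.mem_univ j)
      obtain rfl : (fun j => (y j : ℂ)) = x := funext hy
      rw [hAB, h0.1, h0.2]
      simp
    refine left_ne_zero_of_mul hc ?_
    have h1 := hτ Q fun j => c j.succ / c 0
    rw [hzero, map_zero] at h1
    rw [h1]
    congr 2
    funext j
    refine Fin.cases ?_ (fun j => ?_) j
    · simp
    · simp [mul_div_cancel₀ _ hc0]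
  have hcont : Continuous fun y => ν y i := (continuous_apply i).comp hνc
  rcases hne with hA | hB
  · exact isRationalFunction_of_interior h hcont hA fun y hy => (hkey y hy).1
  · exact isRationalFunction_of_interior h hcont hB fun y hy => (hkey y hy).2

theorem exists_cone_relation_of_isRationalFunction (h : IsToricData a w)
    {ν : domainPolytope (realPoints a) → ι → ℝ}
    (hν : ∀ q ∈ closure (toricModel a w), ∀ y : domainPolytope (realPoints a),
      momentMap a q = y → ν y = q) {i : ι}
    (hrat : ParametricPatch.IsRationalFunction (p := realPoints a) fun y => ν y i) :
    ∃ P Q : MvPolynomial (Fin (d + 1)) ℂ, Q ≠ 0 ∧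
      ∀ v ∈ monomialCone (homogenizedExponents a) (fun i => (w i : ℂ)),
        v i * eval (tautologicalLinear a v) Q = eval (tautologicalLinear a v) P := by
  obtain ⟨P₀, Q₀, hQ₀, hPQ⟩ := hrat
  -- Multiplying numerator and denominator by `Q₀` gives an identity valid on all of `Δ`, also at
  -- the zeros of `Q₀`, where nothing is known about `ν`.
  obtain ⟨D, HP, hHP⟩ := exists_homogenization (P₀ * Q₀)
  obtain ⟨E, HQ, hHQ⟩ := exists_homogenization (Q₀ * Q₀)
  have hfull : ∀ y : domainPolytope (realPoints a),
      ν y i * eval (y : Fin d → ℝ) (Q₀ * Q₀) = eval (y : Fin d → ℝ) (P₀ * Q₀) := by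
    intro y
    rw [map_mul, map_mul]
    by_cases h0 : eval (y : Fin d → ℝ) Q₀ = 0
    · simp [h0]
    · have : ν y i = _ := hPQ y h0
      rw [this]
      field_simp
  -- The powers of `X 0` balance the degrees `D` and `E`; the additional one accounts for `v i`,
  -- which is homogeneous of degree one.
  refine ⟨X 0 ^ (E + 1) * HP, X 0 ^ D * HQ, fun h0 => ?_, fun v hv => ?_⟩
  · refine hQ₀ (MvPolynomial.funext fun y => ?_)
    have := congrArg (eval (Fin.cons 1 fun j => 1 * (y j : ℂ) : Fin (d + 1) → ℂ)) h0
    rw [map_mul, hHQ] at this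
    simpa using this
  · have hF : MvPolynomial.aeval (monomialGenericPoint (homogenizedExponents a)
        (fun i => (w i : ℂ))) (X i * bind₁ (tautologicalForm a) (X 0 ^ D * HQ) -
          bind₁ (tautologicalForm a) (X 0 ^ (E + 1) * HP)) = 0 := by
      refine aeval_monomialGenericPoint_eq_zero_of_pos fun s hs => ?_
      have hx : ∀ j, 0 < Fin.tail s j := fun j => hs j.succ
      have hZ := (sum_weightedMonomials_pos h hx).ne'
      have hZ' : ((∑ k, weightedMonomials a w (Fin.tail s) k : ℝ) : ℂ) ≠ 0 :=
        Complex.ofReal_ne_zero.2 hZ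
      set Z := ∑ k, weightedMonomials a w (Fin.tail s) k with hZdef
      have hmem : (fun i => modelProbability a w i (Fin.tail s)) ∈ closure (toricModel a w) :=
        subset_closure ⟨Fin.tail s, hx, rfl⟩
      have hy := momentMap_mem_domainPolytope (a := a)
        (closure_toricModel_subset_stdSimplex h hmem)
      have hνy := hν _ hmem ⟨_, hy⟩ rfl
      have h1 := hfull ⟨_, hy⟩
      rw [hνy] at h1
      have hlin := tautologicalLinear_weightedMonomials_ofReal h hx ((s 0 : ℂ) * Z)
      rw [mul_div_cancel_right₀ _ hZ'] at hlin
      have hw : weightedMonomials (homogenizedExponents a) (fun i => (w i : ℂ))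
          (fun j => (s j : ℂ)) = (s 0 : ℂ) • weightedMonomials a (fun i => (w i : ℂ))
            (fun j => (Fin.tail s j : ℂ)) :=
        weightedMonomials_homogenizedExponents _ _ _
      rw [map_sub, map_mul, eval_X, eval_bind₁_tautologicalForm, eval_bind₁_tautologicalForm, hw,
        hlin, map_mul, map_mul, hHP, hHQ, ← h1, map_pow, map_pow, eval_X, Fin.cons_zero,
        Pi.smul_apply, smul_eq_mul, weightedMonomials_ofReal]
      simp only [modelProbability, ← hZdef]
      push_cast
      field_simp
      ring
    have := hv _ (aeval_monomialGenericPoint_eq_zero.1 hF)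
    rwa [map_sub, map_mul, eval_X, eval_bind₁_tautologicalForm, eval_bind₁_tautologicalForm,
      sub_eq_zero] at this

theorem exists_degree (h : IsToricData a w) :
    ∃ N : ℕ, (∀ M, (IsMLDegree a w M ↔ M = N) ∧ (IsTautologicalDegree a w M ↔ M = N)) ∧
      ∀ ν : domainPolytope (realPoints a) → ι → ℝ, Continuous ν →
        (∀ q ∈ closure (toricModel a w), ∀ y : domainPolytope (realPoints a),
          momentMap a q = y → ν y = q) →
        (N = 1 ↔ ∀ i, ParametricPatch.IsRationalFunction (p := realPoints a) fun y => ν y i) := by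
  obtain ⟨N, hN, G, hG, hcard⟩ := exists_card_tautological_fibre h
  obtain ⟨hML, hT⟩ := isMLDegree_and_isTautologicalDegree h hG hcard
  refine ⟨N, fun M => ⟨⟨fun hM => hM.unique hML, ?_⟩, ⟨fun hM => hM.unique hT, ?_⟩⟩, ?_⟩
  · rintro rfl
    exact hML
  · rintro rfl
    exact hT
  · intro ν hνc hν
    rw [hN]
    constructor
    · intro h1 i
      obtain ⟨P, Q, hQ, hPQ⟩ := h1 i
      exact isRationalFunction_inverse_of_cone h hνc hν hQ hPQ
    · intro h1 i
      exact exists_cone_relation_of_isRationalFunction h hν (h1 i)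

/-- The maximum likelihood degree is one exactly if the inverse of the moment map is rational. -/
theorem isMLDegree_one_iff (h : IsToricData a w) {ν : domainPolytope (realPoints a) → ι → ℝ}
    (hνc : Continuous ν)
    (hν : ∀ q ∈ closure (toricModel a w), ∀ y : domainPolytope (realPoints a),
      momentMap a q = y → ν y = q) :
    IsMLDegree a w 1 ↔
      ∀ i, ParametricPatch.IsRationalFunction (p := realPoints a) fun y => ν y i := by
  obtain ⟨N, hN, hrat⟩ := exists_degree h
  rw [(hN 1).1, eq_comm, hrat ν hνc hν]

theorem hasRationalLinearPrecision_iff_of_injective (h : IsToricData a w)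
    {β : ParametricPatch (realPoints a)} (hβ : β.IsToric a w)
    (hinj : Function.Injective β.toSimplex) :
    β.HasRationalLinearPrecision ↔ IsMLDegree a w 1 := by
  obtain ⟨ν, hνc, hr, hm, hν⟩ := exists_momentMap_inverse h
  rw [isMLDegree_one_iff h hνc hν]
  exact ⟨fun hR i => hR.isRationalFunction_inverse hν hβ i, fun hrat =>
    ParametricPatch.hasRationalLinearPrecision_of_inverse h hr hm hν hrat hβ hinj⟩

theorem exists_hasRationalLinearPrecision_iff (h : IsToricData a w) :
    (∃ β : ParametricPatch (realPoints a), β.IsToric a w ∧ β.HasRationalLinearPrecision) ↔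
      IsMLDegree a w 1 := by
  obtain ⟨ν, hνc, hr, hm, hν⟩ := exists_momentMap_inverse h
  rw [isMLDegree_one_iff h hνc hν]
  constructor
  · rintro ⟨β, hβ, hR⟩ i
    exact hR.isRationalFunction_inverse hν hβ i
  · intro hrat
    obtain ⟨β, hβ, e⟩ := ParametricPatch.exists_isToric_of_inverse h hνc hr
    refine ⟨β, hβ, ParametricPatch.hasRationalLinearPrecision_of_inverse h hr hm hν hrat hβ ?_⟩
    rw [e]
    intro y y' hyy
    exact Subtype.ext (by rw [← hm y, ← hm y', hyy])

end Rational

/-! ### Decomposable graphical models -/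

section SumOut

open Classical

variable {V : Type*} {S : V → Type*} [Fintype (∀ v, S v)]

/-- Summation over the states of the vertices in `D`. -/
noncomputable def sumOut (D : Set V) (f : (∀ v, S v) → ℝ) (s : ∀ v, S v) : ℝ :=
  ∑ t with ∀ v ∉ D, t v = s v, f t

theorem sumOut_pos (D : Set V) {f : (∀ v, S v) → ℝ} (hf : ∀ s, 0 < f s) (s : ∀ v, S v) :
    0 < sumOut D f s :=
  Finset.sum_pos (fun t _ => hf t) ⟨s, by simp⟩

theorem sumOut_empty (f : (∀ v, S v) → ℝ) : sumOut ∅ f = f := by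
  funext s
  have : (Finset.univ.filter fun t : ∀ v, S v => ∀ v ∉ (∅ : Set V), t v = s v) = {s} := by
    ext t
    simp [funext_iff]
  rw [sumOut, this, Finset.sum_singleton]

theorem sumOut_mul_left {D : Set V} {f : (∀ v, S v) → ℝ} (hf : DependsOn f Dᶜ)
    (g : (∀ v, S v) → ℝ) : sumOut D (f * g) = f * sumOut D g := by
  funext s
  rw [sumOut, Pi.mul_apply, sumOut, Finset.mul_sum]
  refine Finset.sum_congr rfl fun t ht => ?_
  rw [Pi.mul_apply, hf fun v hv => (Finset.mem_filter.1 ht).2 v hv]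

theorem dependsOn_sumOut {D T : Set V} {f : (∀ v, S v) → ℝ} (hf : DependsOn f (T ∪ D)) :
    DependsOn (sumOut D f) T := by
  intro s s' hs
  -- The summation ranges over `s` and `s'` correspond by exchanging the coordinates outside `D`.
  -- Among the coordinates `f` depends on, this changes only those in `T`, where `s` and `s'` agree.
  refine Finset.sum_nbij' (fun t => D.piecewise t s') (fun t => D.piecewise t s) ?_ ?_ ?_ ?_ ?_
  · intro t _
    simp +contextual [Set.piecewise_eq_of_notMem]
  · intro t _
    simp +contextual [Set.piecewise_eq_of_notMem]
  · intro t ht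
    have ht := (Finset.mem_filter.1 ht).2
    funext v
    by_cases hv : v ∈ D
    · simp [hv]
    · simp [hv, ht v hv]
  · intro t ht
    have ht := (Finset.mem_filter.1 ht).2
    funext v
    by_cases hv : v ∈ D
    · simp [hv]
    · simp [hv, ht v hv]
  · intro t ht
    have ht := (Finset.mem_filter.1 ht).2
    refine hf fun v hv => ?_
    by_cases hvD : v ∈ D
    · simp [hvD]
    · rw [Set.piecewise_eq_of_notMem _ _ _ hvD, ht v hvD, hs v (hv.resolve_right hvD)]

theorem sumOut_union {A B : Set V} (hAB : Disjoint A B) (f : (∀ v, S v) → ℝ) :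
    sumOut (A ∪ B) f = sumOut A (sumOut B f) := by
  funext s
  simp only [sumOut]
  rw [Finset.sum_sigma']
  refine Finset.sum_nbij' (fun r => ⟨A.piecewise r s, r⟩) (fun p => p.2) ?_ ?_ ?_ ?_ ?_
  · intro r hr
    have hr := (Finset.mem_filter.1 hr).2
    refine Finset.mem_sigma.2 ⟨Finset.mem_filter.2 ⟨Finset.mem_univ _, fun v hv => ?_⟩,
      Finset.mem_filter.2 ⟨Finset.mem_univ _, fun v hv => ?_⟩⟩
    · exact Set.piecewise_eq_of_notMem _ _ _ hv
    · by_cases hvA : v ∈ A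
      · simp [hvA]
      · simp only [Set.piecewise_eq_of_notMem _ _ _ hvA]
        exact hr v fun h => h.elim hvA hv
  · rintro ⟨t, r⟩ hp
    obtain ⟨ht, hr⟩ := Finset.mem_sigma.1 hp
    have ht := (Finset.mem_filter.1 ht).2
    have hr := (Finset.mem_filter.1 hr).2
    refine Finset.mem_filter.2 ⟨Finset.mem_univ _, fun v hv => ?_⟩
    exact (hr v fun h => hv (Or.inr h)).trans (ht v fun h => hv (Or.inl h))
  · intro r _
    rfl
  · rintro ⟨t, r⟩ hp
    obtain ⟨ht, hr⟩ := Finset.mem_sigma.1 hp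
    have ht := (Finset.mem_filter.1 ht).2
    have hr := (Finset.mem_filter.1 hr).2
    have : A.piecewise r s = t := by
      funext v
      by_cases hv : v ∈ A
      · rw [Set.piecewise_eq_of_mem _ _ _ hv]
        exact hr v (Set.disjoint_left.1 hAB hv)
      · rw [Set.piecewise_eq_of_notMem _ _ _ hv]
        exact (ht v hv).symm
    simp only [this]
  · intro r _
    rfl

end SumOut

/-! ### Factorizations over cliques and products of clique marginals. -/

section CliqueFactorization

variable {V : Type*} {S : V → Type*}

/-- Products of positive functions that depend only on the states in a clique inside `T`. -/
inductive CliqueFactorization (G : SimpleGraph V) (T : Set V) : ((∀ v, S v) → ℝ) → Prop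
  | clique (C : Set V) (f : (∀ v, S v) → ℝ) : C ⊆ T → G.IsClique C → DependsOn f C →
      (∀ s, 0 < f s) → CliqueFactorization G T f
  | mul (f g : (∀ v, S v) → ℝ) : CliqueFactorization G T f → CliqueFactorization G T g →
      CliqueFactorization G T (f * g)

namespace CliqueFactorization

variable {G : SimpleGraph V} {T : Set V} {f : (∀ v, S v) → ℝ}

theorem one : CliqueFactorization G T (1 : (∀ v, S v) → ℝ) :=
  clique ∅ 1 (Set.empty_subset _) (by simp) (fun _ _ _ => rfl) fun _ => one_pos

theorem pos (h : CliqueFactorization G T f) (s : ∀ v, S v) : 0 < f s := by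
  induction h with
  | clique C f _ _ _ hf => exact hf s
  | mul f g _ _ hf hg => exact mul_pos hf hg

theorem dependsOn (h : CliqueFactorization G T f) : DependsOn f T := by
  induction h with
  | clique C f hC _ hf _ => exact fun s t hst => hf fun v hv => hst v (hC hv)
  | mul f g _ _ hf hg => exact fun s t hst => by rw [Pi.mul_apply, Pi.mul_apply, hf hst, hg hst]

/-- No clique meets both `A` and `B`, so each factor belongs to one of the two sides. -/
theorem exists_mul_of_separated {A B C : Set V} (hAB : Disjoint A B)
    (hsep : ∀ x ∈ A, ∀ y ∈ B, ¬ G.Adj x y) (h : CliqueFactorization G (A ∪ B ∪ C) f) :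
    ∃ g g' : (∀ v, S v) → ℝ, CliqueFactorization G (A ∪ C) g ∧
      CliqueFactorization G (B ∪ C) g' ∧ f = g * g' := by
  induction h with
  | clique K f hK hcl hf hpos =>
    by_cases hKA : ∃ x ∈ K, x ∈ A
    · obtain ⟨x, hxK, hxA⟩ := hKA
      refine ⟨f, 1, clique K f (fun y hy => ?_) hcl hf hpos, one, (mul_one f).symm⟩
      rcases hK hy with (hyA | hyB) | hyC
      · exact Or.inl hyA
      · have hne : x ≠ y := fun e => Set.disjoint_left.1 hAB hxA (e ▸ hyB)
        exact absurd (hcl hxK hy hne) (hsep x hxA y hyB)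
      · exact Or.inr hyC
    · refine ⟨1, f, one, clique K f (fun y hy => ?_) hcl hf hpos, (one_mul f).symm⟩
      rcases hK hy with (hyA | hyB) | hyC
      · exact absurd ⟨y, hy, hyA⟩ hKA
      · exact Or.inl hyB
      · exact Or.inr hyC
  | mul f f' _ _ hf hf' =>
    obtain ⟨g, g', hg, hg', rfl⟩ := hf
    obtain ⟨k, k', hk, hk', rfl⟩ := hf'
    exact ⟨g * k, g' * k', hg.mul _ _ hk, hg'.mul _ _ hk', mul_mul_mul_comm _ _ _ _⟩

end CliqueFactorization

open Classical in
/-- The marginals of a distribution that factorizes over a decomposable graph are products of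
powers of clique marginals. -/
theorem SimpleGraph.IsDecomposableOn.exists_marginal_eq_prod [Fintype V] [Fintype (∀ v, S v)]
    {G : SimpleGraph V} {T : Set V} (hT : G.IsDecomposableOn T) :
    ∃ n : Finset V → ℤ, (∀ C, n C ≠ 0 → G.IsClique (C : Set V)) ∧
      ∀ q : (∀ v, S v) → ℝ, (∀ s, 0 < q s) → CliqueFactorization G T (sumOut Tᶜ q) →
        ∀ s, sumOut Tᶜ q s = ∏ C : Finset V, sumOut (C : Set V)ᶜ q s ^ n C := by
  induction hT with
  | complete T hT =>
    refine ⟨Pi.single T.toFinset 1, fun C hC => ?_, fun q _ _ s => ?_⟩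
    · obtain rfl : C = T.toFinset := by
        by_contra h
        exact hC (Pi.single_eq_of_ne h _)
      simpa using hT
    · rw [Finset.prod_eq_single T.toFinset]
      · simp
      · intro C _ hC
        rw [Pi.single_eq_of_ne hC, zpow_zero]
      · simp
  | glue A B C hAB hAC hBC _ _ hC hsep _ _ ih₁ ih₂ =>
    obtain ⟨n₁, hn₁, h₁⟩ := ih₁
    obtain ⟨n₂, hn₂, h₂⟩ := ih₂
    -- With `q_T` the marginal on `T`, this encodes `q_{A∪B∪C} = q_{A∪C} q_{B∪C} / q_C`. For
    -- `q_{A∪B∪C} = f g` the three marginals on the right are `f ∑_B g`, `g ∑_A f` and `∑_B g ∑_A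
    -- f`.
    refine ⟨n₁ + n₂ - Pi.single C.toFinset 1, fun K hK => ?_, fun q hq hfac s => ?_⟩
    · by_cases hKC : K = C.toFinset
      · rw [hKC]
        simpa using hC
      · by_cases h1 : n₁ K = 0
        · refine hn₂ K fun h2 => hK ?_
          simp [h1, h2, Pi.single_eq_of_ne hKC]
        · exact hn₁ K h1
    · obtain ⟨f, g, hf, hg, hfg⟩ := hfac.exists_mul_of_separated hAB hsep
      have hAC' : sumOut (A ∪ C)ᶜ q = sumOut B (f * g) := by
        rw [← hfg, ← sumOut_union]
        · congr 1
          ext v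
          have h1 : v ∈ A → v ∉ B := fun h => Set.disjoint_left.1 hAB h
          have h2 : v ∈ B → v ∉ C := fun h => Set.disjoint_left.1 hBC h
          simp only [Set.mem_compl_iff, Set.mem_union]
          tauto
        · exact Set.disjoint_left.2 fun v hv hv' => hv' (Or.inl (Or.inr hv))
      have hBC' : sumOut (B ∪ C)ᶜ q = sumOut A (f * g) := by
        rw [← hfg, ← sumOut_union]
        · congr 1
          ext v
          have h1 : v ∈ A → v ∉ B := fun h => Set.disjoint_left.1 hAB h
          have h2 : v ∈ A → v ∉ C := fun h => Set.disjoint_left.1 hAC h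
          simp only [Set.mem_compl_iff, Set.mem_union]
          tauto
        · exact Set.disjoint_left.2 fun v hv hv' => hv' (Or.inl (Or.inl hv))
      have hC' : sumOut Cᶜ q = sumOut A (sumOut (A ∪ C)ᶜ q) := by
        rw [← sumOut_union]
        · congr 1
          ext v
          have h2 : v ∈ A → v ∉ C := fun h => Set.disjoint_left.1 hAC h
          simp only [Set.mem_compl_iff, Set.mem_union]
          tauto
        · exact Set.disjoint_left.2 fun v hv hv' => hv' (Or.inl hv)
      have e₁ : sumOut (A ∪ C)ᶜ q = f * sumOut B g := by
        rw [hAC']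
        refine sumOut_mul_left (fun s t hst => hf.dependsOn fun v hv => hst v fun hvB => ?_) g
        rcases hv with hv | hv
        · exact Set.disjoint_left.1 hAB hv hvB
        · exact Set.disjoint_left.1 hBC hvB hv
      have e₂ : sumOut (B ∪ C)ᶜ q = g * sumOut A f := by
        rw [hBC', mul_comm]
        refine sumOut_mul_left (fun s t hst => hg.dependsOn fun v hv => hst v fun hvA => ?_) f
        rcases hv with hv | hv
        · exact Set.disjoint_left.1 hAB hvA hv
        · exact Set.disjoint_left.1 hAC hvA hv
      have hdep : DependsOn (sumOut B g) C := dependsOn_sumOut (by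
        rw [Set.union_comm]
        exact hg.dependsOn)
      have e₃ : sumOut Cᶜ q = sumOut B g * sumOut A f := by
        rw [hC', e₁, mul_comm]
        exact sumOut_mul_left (fun s t hst => hdep fun v hv => hst v fun hvA =>
          Set.disjoint_left.1 hAC hvA hv) f
      -- The induction hypotheses apply to the marginals on both sides: the new factor depends only
      -- on `C`, which is a clique.
      have hfac₁ : CliqueFactorization G (A ∪ C) (sumOut (A ∪ C)ᶜ q) := by
        rw [e₁]
        exact hf.mul _ _ (.clique C _ Set.subset_union_right hC hdep
          fun s => sumOut_pos _ hg.pos s)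
      have hfac₂ : CliqueFactorization G (B ∪ C) (sumOut (B ∪ C)ᶜ q) := by
        rw [e₂]
        refine hg.mul _ _ (.clique C _ Set.subset_union_right hC (dependsOn_sumOut (by
          rw [Set.union_comm]
          exact hf.dependsOn)) fun s => sumOut_pos _ hf.pos s)
      have hpos : ∀ K : Finset V, sumOut (K : Set V)ᶜ q s ≠ 0 := fun K => (sumOut_pos _ hq s).ne'
      have hsingle : ∏ K : Finset V, sumOut (K : Set V)ᶜ q s ^
          (Pi.single C.toFinset 1 : Finset V → ℤ) K = sumOut Cᶜ q s := by
        rw [Finset.prod_eq_single C.toFinset]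
        · simp
        · intro K _ hK
          rw [Pi.single_eq_of_ne hK, zpow_zero]
        · simp
      simp only [Pi.sub_apply, Pi.add_apply, zpow_sub₀ (hpos _), zpow_add₀ (hpos _),
        Finset.prod_div_distrib, Finset.prod_mul_distrib]
      rw [hsingle, ← h₁ q hq hfac₁ s, ← h₂ q hq hfac₂ s, e₁, e₂, e₃, hfg]
      have p₁ := (sumOut_pos B hg.pos s).ne'
      have p₂ := (sumOut_pos A hf.pos s).ne'
      simp only [Pi.mul_apply]
      field_simp

/-- Membership in the graphical model in terms of clique factorizations. -/
theorem mem_graphicalModel_iff [Fintype V] [Fintype (∀ v, S v)] {G : SimpleGraph V}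
    {q : (∀ v, S v) → ℝ} :
    q ∈ graphicalModel G S ↔ ∑ s, q s = 1 ∧ CliqueFactorization G Set.univ q := by
  classical
  constructor
  · rintro ⟨-, hsum, ψ, hpos, hdep, hq⟩
    refine ⟨hsum, ?_⟩
    rw [show q = ∏ C ∈ Finset.univ.filter (fun C : Finset V => G.IsClique (C : Set V)), ψ C by
      funext s
      rw [hq, Finset.prod_apply]]
    refine Finset.prod_induction _ (CliqueFactorization G Set.univ) (fun f g hf hg => hf.mul _ _ hg)
      .one fun C hC => ?_
    exact .clique C _ (Set.subset_univ _) (Finset.mem_filter.1 hC).2 (fun s t h => hdep C s t h)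
      (hpos C)
  · rintro ⟨hsum, hq⟩
    refine ⟨hq.pos, hsum, ?_⟩
    clear hsum
    induction hq with
    | clique C f _ hC hf hpos =>
      refine ⟨fun D => if D = C.toFinset then f else 1, fun D s => ?_, fun D s t hst => ?_,
        fun s => ?_⟩
      · dsimp only
        split_ifs
        · exact hpos s
        · exact one_pos
      · dsimp only
        split_ifs with h
        · exact hf fun v hv => hst v (by rw [h]; simpa using hv)
        · rfl
      · rw [Finset.prod_eq_single C.toFinset]
        · simp
        · intro D _ hD
          simp [hD]
        · intro h
          simp [hC] at h
    | mul f g _ _ hf hg =>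
      obtain ⟨ψ, h1, h2, h3⟩ := hf
      obtain ⟨ψ', h1', h2', h3'⟩ := hg
      refine ⟨fun C => ψ C * ψ' C, fun C s => mul_pos (h1 C s) (h1' C s), fun C s t hst => ?_,
        fun s => ?_⟩
      · dsimp only
        rw [Pi.mul_apply, Pi.mul_apply, h2 C s t hst, h2' C s t hst]
      · simp only [Pi.mul_apply, h3, h3', Finset.prod_mul_distrib]

end CliqueFactorization

/-! ### Graphical models as toric models, and their maximum likelihood degree. -/

section GraphicalToric

open Classical

variable {V : Type*} {S : V → Type*}

/-- The indicator function of the joint states that agree with `s` on `C`. -/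
noncomputable def stateIndicator (C : Set V) (s t : ∀ v, S v) : ℝ :=
  if ∀ v ∈ C, t v = s v then 1 else 0

theorem dependsOn_stateIndicator (C : Set V) (s : ∀ v, S v) :
    DependsOn (stateIndicator C s) C := by
  intro t t' h
  have : (∀ v ∈ C, t v = s v) ↔ ∀ v ∈ C, t' v = s v :=
    forall₂_congr fun v hv => by rw [h v hv]
  simp only [stateIndicator, this]

theorem sumOut_compl_eq_sum_stateIndicator [Fintype (∀ v, S v)] (C : Set V)
    (q : (∀ v, S v) → ℝ) (s : ∀ v, S v) : sumOut Cᶜ q s = ∑ t, q t * stateIndicator C s t := by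
  simp only [sumOut, stateIndicator, mul_ite, mul_one, mul_zero, Finset.sum_filter,
    Set.mem_compl_iff, not_not]

theorem mem_span_stateIndicator [Fintype (∀ v, S v)] {C : Set V} {f : (∀ v, S v) → ℝ}
    (hf : DependsOn f C) :
    f ∈ Submodule.span ℝ (Set.range fun s : ∀ v, S v => stateIndicator C s) := by
  -- `n s` is the number of states agreeing with `s` on `C`; dividing by it corrects for the
  -- repetition of equal indicators in the sum over all states.
  let n : (∀ v, S v) → ℝ := fun s => ∑ t, stateIndicator C s t
  have hn : ∀ s, n s ≠ 0 := fun s => by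
    refine (Finset.sum_pos' (fun t _ => ?_) ⟨s, Finset.mem_univ s, ?_⟩).ne'
    · unfold stateIndicator
      split_ifs <;> norm_num
    · simp [stateIndicator]
  have hsymm : ∀ s t : ∀ v, S v, stateIndicator C s t = stateIndicator C t s := fun s t => by
    have : (∀ v ∈ C, t v = s v) ↔ ∀ v ∈ C, s v = t v := forall₂_congr fun v _ => eq_comm
    simp only [stateIndicator, this]
  have hf' : f = ∑ t, (f t / n t) • stateIndicator C t := by
    funext s
    rw [Finset.sum_apply]
    have : ∀ t, ((f t / n t) • stateIndicator C t) s = f s / n s * stateIndicator C s t := by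
      intro t
      rw [Pi.smul_apply, smul_eq_mul, hsymm t s]
      by_cases h : ∀ v ∈ C, t v = s v
      · have hnt : n t = n s := Finset.sum_congr rfl fun r _ => by
          rw [hsymm t r, hsymm s r]
          exact dependsOn_stateIndicator C r h
        rw [hf h, hnt]
      · simp [stateIndicator, h]
    rw [Finset.sum_congr rfl fun t _ => this t, ← Finset.mul_sum, div_mul_cancel₀ _ (hn s)]
  rw [hf']
  exact Submodule.sum_mem _ fun t _ => Submodule.smul_mem _ _ (Submodule.subset_span ⟨t, rfl⟩)

/-- The indicator functions of the states of cliques. -/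
def cliqueIndicators (G : SimpleGraph V) (S : V → Type*) : Set ((∀ v, S v) → ℝ) :=
  {f | ∃ (C : Set V) (s : ∀ v, S v), G.IsClique C ∧ f = stateIndicator C s}

/-- The logarithm turns the multiplicative model into a linear space, of which a basis will supply
the exponents. -/
theorem CliqueFactorization.log_mem_span [Fintype (∀ v, S v)] {G : SimpleGraph V} {T : Set V}
    {q : (∀ v, S v) → ℝ} (hq : CliqueFactorization G T q) :
    (fun s => Real.log (q s)) ∈ Submodule.span ℝ (cliqueIndicators G S) := by
  induction hq with
  | clique C f _ hC hf _ =>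
    refine Submodule.span_mono ?_ (mem_span_stateIndicator (C := C) fun s t h => by rw [hf h])
    rintro _ ⟨s, rfl⟩
    exact ⟨C, s, hC, rfl⟩
  | mul f g hf hg ihf ihg =>
    have : (fun s => Real.log ((f * g) s)) =
        (fun s => Real.log (f s)) + fun s => Real.log (g s) := by
      funext s
      exact Real.log_mul (hf.pos s).ne' (hg.pos s).ne'
    rw [this]
    exact Submodule.add_mem _ ihf ihg

/-- Points span the affine space if no non-trivial affine function is constant on them. -/
theorem affineSpan_eq_top_of_forall {ι : Type*} [Nonempty ι] {d : ℕ} {p : ι → Fin d → ℝ}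
    (h : ∀ (l : Fin d → ℝ) (c : ℝ), (∀ i, ∑ j, l j * p i j = c) → l = 0) :
    affineSpan ℝ (Set.range p) = ⊤ := by
  have hne : (affineSpan ℝ (Set.range p) : Set (Fin d → ℝ)).Nonempty :=
    (affineSpan_nonempty ℝ).2 (Set.range_nonempty p)
  rw [← AffineSubspace.direction_eq_top_iff_of_nonempty hne]
  by_contra htop
  obtain ⟨f, hf, hker⟩ := Submodule.exists_le_ker_of_lt_top _ (lt_top_iff_ne_top.2 htop)
  obtain ⟨i₀⟩ := ‹Nonempty ι›
  have hfsum : ∀ u : Fin d → ℝ, f u = ∑ j, f (Pi.single j 1) * u j := by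
    intro u
    rw [LinearMap.pi_apply_eq_sum_univ f u]
    refine Finset.sum_congr rfl fun j _ => ?_
    rw [smul_eq_mul, mul_comm]
    congr 2
    funext l
    simp [Pi.single_apply, eq_comm]
  have h0 := h (fun j => f (Pi.single j 1)) (f (p i₀)) fun i => by
    rw [← hfsum]
    have : f (p i -ᵥ p i₀) = 0 := hker (AffineSubspace.vsub_mem_direction
      (subset_affineSpan ℝ _ ⟨i, rfl⟩) (subset_affineSpan ℝ _ ⟨i₀, rfl⟩))
    rwa [vsub_eq_sub, map_sub, sub_eq_zero] at this
  refine hf (LinearMap.ext fun u => ?_)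
  rw [hfsum]
  exact Finset.sum_eq_zero fun j _ => by rw [congrFun h0 j, Pi.zero_apply, zero_mul]

/-- Every graphical model is a toric model. -/
theorem exists_toricModel_eq_graphicalModel [Fintype V] (G : SimpleGraph V) [∀ v, Nonempty (S v)]
    [Fintype (∀ v, S v)] :
    ∃ (d : ℕ) (a : (∀ v, S v) → Fin d → ℤ) (w : (∀ v, S v) → ℝ),
      IsToricData a w ∧ toricModel a w = graphicalModel G S := by
  obtain ⟨s₀⟩ : Nonempty (∀ v, S v) := inferInstance
  have hone : (1 : (∀ v, S v) → ℝ) ∈ cliqueIndicators G S :=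
    ⟨∅, s₀, by simp, by funext t; simp [stateIndicator]⟩
  have hone0 : (1 : (∀ v, S v) → ℝ) ≠ 0 := fun h => one_ne_zero (congrFun h s₀)
  -- Choose a basis of the span of the indicators that contains the constant `1`. The other basis
  -- elements are the coordinates of the exponents, while `1` accounts for normalization.
  obtain ⟨b, hbB, h1b, hspan, hlin⟩ := exists_linearIndepOn_id_extension (K := ℝ)
    (s := {(1 : (∀ v, S v) → ℝ)}) (t := cliqueIndicators G S)
    ((linearIndepOn_singleton_iff ℝ).2 hone0)
    (Set.singleton_subset_iff.2 hone)
  have hfin : (b \ {1}).Finite := (LinearIndependent.setFinite hlin).subset Set.sdiff_subset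
  have := hfin.fintype
  let d := Fintype.card ↥(b \ {(1 : (∀ v, S v) → ℝ)})
  let e : Fin d ≃ ↥(b \ {(1 : (∀ v, S v) → ℝ)}) := (Fintype.equivFin _).symm
  let φ : Fin d → (∀ v, S v) → ℝ := fun j => (e j).1
  have hφ : ∀ j, ∃ (C : Set V) (s : ∀ v, S v), G.IsClique C ∧ φ j = stateIndicator C s :=
    fun j => hbB (e j).2.1
  choose C s hC hφs using hφ
  let a : (∀ v, S v) → Fin d → ℤ := fun t j => if ∀ v ∈ C j, t v = s j v then 1 else 0
  have ha : ∀ t j, (a t j : ℝ) = φ j t := by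
    intro t j
    rw [hφs, stateIndicator]
    simp only [a]
    split_ifs <;> simp
  have hspan' : ∀ f ∈ Submodule.span ℝ (cliqueIndicators G S), ∃ (c : ℝ) (θ : Fin d → ℝ),
      ∀ t, f t = c + ∑ j, θ j * a t j := by
    intro f hf
    have hf : f ∈ Submodule.span ℝ b := Submodule.span_le.2 hspan hf
    have hb : b = insert 1 (Set.range φ) := by
      have : Set.range φ = b \ {1} := by
        rw [show φ = Subtype.val ∘ e from rfl, e.surjective.range_comp, Subtype.range_coe]
      rw [this, Set.insert_sdiff_singleton, Set.insert_eq_of_mem (h1b rfl)]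
    rw [hb, Submodule.mem_span_insert] at hf
    obtain ⟨c, z, hz, rfl⟩ := hf
    obtain ⟨θ, rfl⟩ := (Submodule.mem_span_range_iff_exists_fun ℝ).1 hz
    refine ⟨c, θ, fun t => ?_⟩
    simp [Finset.sum_apply, ha]
  have hdata : IsToricData a (fun _ => (1 : ℝ)) := by
    refine ⟨fun t t' htt => ?_, ?_, fun _ => one_pos⟩
    · funext v
      -- A single vertex is a clique, so the states at each vertex can be read off from the
      -- exponents.
      have hmem : stateIndicator {v} t ∈ Submodule.span ℝ (cliqueIndicators G S) :=
        Submodule.subset_span ⟨{v}, t, by simp, rfl⟩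
      obtain ⟨c, θ, hf⟩ := hspan' _ hmem
      have h1 := hf t
      have h2 := hf t'
      rw [htt, ← h2] at h1
      by_contra hne
      simp [stateIndicator, Ne.symm hne] at h1
    · rw [domainPolytope, affineSpan_convexHull]
      have : Nonempty (∀ v, S v) := ⟨s₀⟩
      refine affineSpan_eq_top_of_forall fun l c hl => ?_
      -- `none` stands for the constant `1`: an affine function vanishing at all exponents is a
      -- linear relation in the basis.
      let g : Option (Fin d) → b := fun o => o.elim ⟨1, h1b rfl⟩ fun j => ⟨φ j, (e j).2.1⟩
      have hg : Function.Injective g := by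
        rintro (_ | j) (_ | j') hjj
        · rfl
        · exact absurd (congrArg Subtype.val hjj).symm (e j').2.2
        · exact absurd (congrArg Subtype.val hjj) (e j).2.2
        · have h1 : (g (some j)).1 = (g (some j')).1 := congrArg Subtype.val hjj
          have h2 : e j = e j' := Subtype.ext h1
          rw [e.injective h2]
      have hlin' := LinearIndependent.comp hlin g hg
      rw [Fintype.linearIndependent_iff] at hlin'
      have h0 := hlin' (fun o => o.elim (-c) l) (by
        funext t
        rw [Fintype.sum_option, Pi.add_apply, Finset.sum_apply]
        have := hl t
        simp only [realPoints, ha] at this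
        simp [g, this])
      funext j
      exact h0 (some j)
  refine ⟨d, a, fun _ => 1, hdata, Set.Subset.antisymm ?_ ?_⟩
  · rintro _ ⟨x, hx, rfl⟩
    rw [mem_graphicalModel_iff]
    refine ⟨sum_modelProbability hdata hx, ?_⟩
    have hZ := sum_weightedMonomials_pos hdata hx
    have : (fun t => modelProbability a (fun _ => (1 : ℝ)) t x) =
        (fun _ => (∑ k, weightedMonomials a (fun _ => (1 : ℝ)) x k)⁻¹) *
          ∏ j, fun t => x j ^ a t j := by
      funext t
      rw [Pi.mul_apply, Finset.prod_apply, modelProbability, weightedMonomials, one_mul,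
        div_eq_inv_mul]
    rw [this]
    refine .mul _ _ (.clique ∅ _ (Set.empty_subset _) (by simp) (fun _ _ _ => rfl)
      fun _ => inv_pos.2 hZ) ?_
    refine Finset.prod_induction _ (CliqueFactorization G Set.univ) (fun f g hf hg => hf.mul _ _ hg)
      .one fun j _ => ?_
    refine .clique (C j) _ (Set.subset_univ _) (hC j) (fun t t' htt => ?_)
      fun t => zpow_pos (hx j) _
    have : a t j = a t' j := by
      have h1 := ha t j
      rw [hφs, dependsOn_stateIndicator (C j) (s j) htt, ← hφs, ← ha] at h1
      exact_mod_cast h1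
    simp only [this]
  · intro q hq
    rw [mem_graphicalModel_iff] at hq
    obtain ⟨hsum, hfac⟩ := hq
    obtain ⟨c, θ, hθ⟩ := hspan' _ hfac.log_mem_span
    have hx : ∀ j, 0 < Real.exp (θ j) := fun j => Real.exp_pos _
    refine ⟨fun j => Real.exp (θ j), hx, ?_⟩
    have hq : ∀ t, q t =
        Real.exp c * weightedMonomials a (fun _ => (1 : ℝ)) (fun j => Real.exp (θ j)) t := by
      intro t
      rw [weightedMonomials, one_mul, prod_exp_zpow, ← Real.exp_add, ← hθ, Real.exp_log (hfac.pos t)]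
    have hZ := sum_weightedMonomials_pos hdata hx
    have hc : Real.exp c * ∑ k, weightedMonomials a (fun _ => (1 : ℝ))
        (fun j => Real.exp (θ j)) k = 1 := by
      rw [Finset.mul_sum]
      exact (Finset.sum_congr rfl fun t _ => (hq t).symm).trans hsum
    funext t
    rw [hq, modelProbability, eq_div_iff hZ.ne', mul_right_comm, hc, one_mul]

/-- If the graphical model is a toric model, then the indicator functions of the states of
cliques are affine functions of the exponents. -/
theorem exists_stateIndicator_eq_affine [Fintype V] {G : SimpleGraph V} [Fintype (∀ v, S v)]
    {d : ℕ} {a : (∀ v, S v) → Fin d → ℤ} {w : (∀ v, S v) → ℝ} (h : IsToricData a w)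
    (hG : toricModel a w = graphicalModel G S) {C : Set V} (hC : G.IsClique C) (s : ∀ v, S v) :
    ∃ (c : ℝ) (l : Fin d → ℝ), ∀ t, stateIndicator C s t = c + ∑ j, l j * a t j := by
  have hlog : ∀ q ∈ toricModel a w, ∃ (c : ℝ) (θ : Fin d → ℝ),
      ∀ t, Real.log (q t) = Real.log (w t) + ∑ j, θ j * a t j - c := by
    rintro _ ⟨x, hx, rfl⟩
    refine ⟨Real.log (∑ k, weightedMonomials a w x k), fun j => Real.log (x j), fun t => ?_⟩
    have hZ := (sum_weightedMonomials_pos h hx).ne'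
    have hprod : (∏ j, x j ^ a t j) ≠ 0 :=
      Finset.prod_ne_zero_iff.2 fun j _ => (zpow_pos (hx j) _).ne'
    simp only [modelProbability]
    rw [Real.log_div (weightedMonomials_pos h.pos hx t).ne' hZ, weightedMonomials,
      Real.log_mul (h.pos t).ne' hprod, Real.log_prod fun j _ => (zpow_pos (hx j) _).ne']
    simp only [Real.log_zpow, mul_comm]
  obtain ⟨q, hq⟩ : (toricModel a w).Nonempty := ⟨_, 1, fun _ => one_pos, rfl⟩
  have hq' := hq
  rw [hG, mem_graphicalModel_iff] at hq'
  obtain ⟨hsum, hfac⟩ := hq'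
  -- Multiplying a model point by `exp` of the indicator and renormalizing stays in the graphical
  -- model. Logarithms of model points are `log w` plus an affine function of the exponents, so in
  -- the difference `log w` cancels.
  let Z : ℝ := ∑ t, q t * Real.exp (stateIndicator C s t)
  have hne : Nonempty (∀ v, S v) := h.nonempty
  have hZ : 0 < Z := Finset.sum_pos (fun t _ => mul_pos (hfac.pos t) (Real.exp_pos _))
    Finset.univ_nonempty
  let k : (∀ v, S v) → ℝ := fun t => Real.exp (stateIndicator C s t) / Z
  have hk : ∀ t, 0 < k t := fun t => div_pos (Real.exp_pos _) hZ
  have hqk : q * k ∈ toricModel a w := by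
    rw [hG, mem_graphicalModel_iff]
    refine ⟨?_, hfac.mul _ _ (.clique C k (Set.subset_univ _) hC (fun t t' htt => ?_) hk)⟩
    · simp only [Pi.mul_apply, k, mul_div_assoc']
      rw [← Finset.sum_div, div_self hZ.ne']
    · simp only [k, dependsOn_stateIndicator C s htt]
  obtain ⟨c, θ, h1⟩ := hlog q hq
  obtain ⟨c', θ', h2⟩ := hlog _ hqk
  refine ⟨c - c' + Real.log Z, θ' - θ, fun t => ?_⟩
  have h3 := h2 t
  rw [Pi.mul_apply, Real.log_mul (hfac.pos t).ne' (hk t).ne', h1,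
    Real.log_div (Real.exp_pos _).ne' hZ.ne', Real.log_exp] at h3
  simp only [Pi.sub_apply, sub_mul, Finset.sum_sub_distrib]
  linarith

/-- The maximum likelihood degree of a decomposable graphical model is one. -/
theorem isMLDegree_one_of_isDecomposableOn [Fintype V] {G : SimpleGraph V} [Fintype (∀ v, S v)]
    (hdec : G.IsDecomposableOn Set.univ) {d : ℕ} {a : (∀ v, S v) → Fin d → ℤ}
    {w : (∀ v, S v) → ℝ} (h : IsToricData a w) (hG : toricModel a w = graphicalModel G S) :
    IsMLDegree a w 1 := by
  obtain ⟨ν, hνc, -, -, hν⟩ := exists_momentMap_inverse h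
  rw [isMLDegree_one_iff h hνc hν]
  intro s
  obtain ⟨n, hn, hprod⟩ := hdec.exists_marginal_eq_prod (S := S)
  -- the clique marginals are values of affine functions at the moments
  have hmarg : ∀ C : Finset V, ∃ l : MvPolynomial (Fin d) ℝ, n C ≠ 0 →
      ∀ q : (∀ v, S v) → ℝ, ∑ t, q t = 1 →
        sumOut (C : Set V)ᶜ q s = MvPolynomial.eval (momentMap a q) l := by
    intro C
    by_cases hC : n C = 0
    · exact ⟨0, fun h => absurd hC h⟩
    · obtain ⟨c, l, hl⟩ := exists_stateIndicator_eq_affine h hG (hn C hC) s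
      refine ⟨MvPolynomial.C c + ∑ j, MvPolynomial.C (l j) * MvPolynomial.X j, fun _ q hq => ?_⟩
      rw [sumOut_compl_eq_sum_stateIndicator]
      simp only [hl, mul_add, Finset.sum_add_distrib, ← Finset.sum_mul, hq, one_mul, map_add,
        map_sum, map_mul, MvPolynomial.eval_C, MvPolynomial.eval_X, momentMap_apply,
        Finset.mul_sum]
      congr 1
      rw [Finset.sum_comm]
      exact Finset.sum_congr rfl fun j _ => Finset.sum_congr rfl fun t _ => mul_left_comm _ _ _
  choose l hl using hmarg
  -- Over the interior `ν y` lies in the model itself, not only in its closure, so it is positive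
  -- and the product formula applies.
  have hval : ∀ y : domainPolytope (realPoints a),
      (y : Fin d → ℝ) ∈ interior (domainPolytope (realPoints a)) →
      (∀ C, n C ≠ 0 → 0 < MvPolynomial.eval (y : Fin d → ℝ) (l C)) ∧
        ν y s = ∏ C, MvPolynomial.eval (y : Fin d → ℝ) (l C) ^ n C := by
    intro y hy
    obtain ⟨x, hx, hxy⟩ := exists_momentMap_eq_of_mem_interior h hy
    have hmem : (fun i => modelProbability a w i x) ∈ toricModel a w := ⟨x, hx, rfl⟩
    have hνy := hν _ (subset_closure hmem) y hxy
    rw [← hνy] at hmem hxy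
    rw [hG, mem_graphicalModel_iff] at hmem
    obtain ⟨hsum, hfac⟩ := hmem
    have hpos : ∀ C, n C ≠ 0 → sumOut (C : Set V)ᶜ (ν y) s =
        MvPolynomial.eval (y : Fin d → ℝ) (l C) := fun C hC => by
      rw [hl C hC _ hsum, hxy]
    refine ⟨fun C hC => ?_, ?_⟩
    · rw [← hpos C hC]
      exact sumOut_pos _ hfac.pos s
    · have := hprod (ν y) hfac.pos (by rwa [Set.compl_univ, sumOut_empty]) s
      rw [Set.compl_univ, sumOut_empty] at this
      rw [this]
      refine Finset.prod_congr rfl fun C _ => ?_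
      by_cases hC : n C = 0
      · rw [hC, zpow_zero, zpow_zero]
      · rw [hpos C hC]
  -- Positive exponents go to the numerator and negative ones to the denominator. The latter is
  -- non-zero because the marginals are positive over interior points.
  refine isRationalFunction_of_interior h (P := ∏ C, l C ^ (n C).toNat)
    (Q := ∏ C, l C ^ (-n C).toNat) ((continuous_apply s).comp hνc) (fun h0 => ?_) fun y hy => ?_
  · obtain ⟨y, hy⟩ := interior_domainPolytope_nonempty h
    have h1 := congrArg (MvPolynomial.eval y) h0
    rw [map_zero, map_prod] at h1
    refine Finset.prod_ne_zero_iff.2 (fun C _ => ?_) h1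
    by_cases hC : n C = 0
    · simp [hC]
    · rw [map_pow]
      exact pow_ne_zero _ ((hval ⟨y, interior_subset hy⟩ hy).1 C hC).ne'
  · obtain ⟨hpos, hνy⟩ := hval y hy
    simp only [hνy, map_prod, map_pow, ← Finset.prod_mul_distrib]
    refine Finset.prod_congr rfl fun C _ => ?_
    by_cases hC : n C = 0
    · simp [hC]
    · rw [← zpow_natCast, ← zpow_natCast, ← zpow_add₀ (hpos C hC).ne']
      congr 1
      lia

end GraphicalToric

theorem proposition4p1 :
    (∀ (d : ℕ) (ι : Type*) [Fintype ι] (a : ι → Fin d → ℤ) (w : ι → ℝ), IsToricData a w →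
      ((∃ β : ParametricPatch (realPoints a), β.IsToric a w ∧ β.HasRationalLinearPrecision) ↔
        IsMLDegree a w 1) ∧
      (∀ β : ParametricPatch (realPoints a), β.IsToric a w → Function.Injective β.toSimplex →
        (β.HasRationalLinearPrecision ↔ IsMLDegree a w 1)) ∧
      (∃ N : ℕ, ∀ M : ℕ, (IsMLDegree a w M ↔ M = N) ∧ (IsTautologicalDegree a w M ↔ M = N))) ∧
    (∀ (V : Type*) [Fintype V] (G : SimpleGraph V) (S : V → Type*) [∀ v, Nonempty (S v)]
      [Fintype (∀ v, S v)], G.IsDecomposableOn Set.univ →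
      (∃ (d : ℕ) (a : (∀ v, S v) → Fin d → ℤ) (w : (∀ v, S v) → ℝ),
        IsToricData a w ∧ toricModel a w = graphicalModel G S) ∧
      ∀ (d : ℕ) (a : (∀ v, S v) → Fin d → ℤ) (w : (∀ v, S v) → ℝ),
        IsToricData a w → toricModel a w = graphicalModel G S →
        IsMLDegree a w 1 ∧
        (∃ β : ParametricPatch (realPoints a), β.IsToric a w ∧ β.HasRationalLinearPrecision) ∧
        ∀ β : ParametricPatch (realPoints a), β.IsToric a w → Function.Injective β.toSimplex →
          β.HasRationalLinearPrecision) := by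
  refine ⟨fun d ι _ a w h => ⟨exists_hasRationalLinearPrecision_iff h,
    fun β hβ hinj => hasRationalLinearPrecision_iff_of_injective h hβ hinj, ?_⟩,
    fun V _ G S _ _ hdec => ⟨exists_toricModel_eq_graphicalModel G, fun d a w h hG => ?_⟩⟩
  · obtain ⟨N, hN, -⟩ := exists_degree h
    exact ⟨N, hN⟩
  · have hML := isMLDegree_one_of_isDecomposableOn hdec h hG
    exact ⟨hML, (exists_hasRationalLinearPrecision_iff h).2 hML, fun β hβ hinj =>
      (hasRationalLinearPrecision_iff_of_injective h hβ hinj).2 hML⟩
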